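/- Let $M=\partial [0,1]^3\subset\mathbb R^3$ be the surface of the unit cube, with its intrinsic metric $d$ ($d(p,q)$ is the infimum of the lengths of the paths in $M$ from $p$ to $q$). For $p\in M$ let $f(p)=\{q\in M : d(p,q)\ge d(p,q') \text{ for all } q'\in M\}$ be the set of farthest points of $p$. An orbit of the multivalued map $f$ is a sequence $(q_i)_{i\ge0}$ in $M$ with $q_{i+1}\in f(q_i)$ for all $i\ge 0$, and the limit set of $f$ is the set of all accumulation points (limits of subsequences) of all orbits. Let $\iota(x,y,z)=(1-x,1-y,1-z)$. **Proposition.** The limit set of the farthest point map $f$ on $M$ is the union of the (two) diagonals of the six square facets of $M$. Moreover, let $p=(a,b,0)$ with $0\le b\le a<1/2$. Then $$\iota(f(p))=\left\{\left(\max\left\{\frac{a+2b(1-b)}{3-2a},\ \frac{(a+b)(1-b)}{2+b-a}\right\},\,b,\,0\right)\right\},$$ the iterates $(\iota\circ f)^k(p)$ are one-point sets $\{q_k\}$ for all $k\ge0$, and $\lim_{k\to\infty}q_k=(b,b,0)$. -/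

import Mathlib

open Set Filter Topology

namespace FarthestPoint

/-- Euclidean three-space. -/
abbrev E3 : Type := EuclideanSpace ℝ (Fin 3)

/-- The continuous paths `γ : [0,1] → M` from `p` to `q`; only the values of `γ` on `[0,1]`
are relevant. -/
def pathsIn (M : Set E3) (p q : E3) : Set (ℝ → E3) :=
  {γ | ContinuousOn γ (Icc 0 1) ∧ MapsTo γ (Icc 0 1) M ∧ γ 0 = p ∧ γ 1 = q}

/-- The intrinsic (length) distance on `M`: the infimum of the Euclidean lengths of the paths
in `M` from `p` to `q`, the length of a path being its total variation. The value is `∞` exactly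
when there is no path of finite length in `M` from `p` to `q`. -/
noncomputable def intrinsicDist (M : Set E3) (p q : E3) : ENNReal :=
  ⨅ γ ∈ pathsIn M p q, eVariationOn γ (Icc 0 1)

/-- The set `f(p)` of the farthest points of `p` in `M` for the intrinsic distance. -/
def farthest (M : Set E3) (p : E3) : Set E3 :=
  {q | q ∈ M ∧ ∀ q' ∈ M, intrinsicDist M p q' ≤ intrinsicDist M p q}

/-- An orbit of the multivalued farthest point map of `M`. -/
def IsOrbit (M : Set E3) (q : ℕ → E3) : Prop :=
  q 0 ∈ M ∧ ∀ i, q (i + 1) ∈ farthest M (q i)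

/-- The limit set of the farthest point map of `M`: all the accumulation points
(limits of subsequences) of all its orbits. -/
def limitSet (M : Set E3) : Set E3 :=
  {x | ∃ q : ℕ → E3, IsOrbit M q ∧ MapClusterPt x atTop q}

/-- The solid unit cube `[0,1]³`. -/
def cube : Set E3 := {x | ∀ i, x i ∈ Icc (0 : ℝ) 1}

/-- The surface of the cube. -/
def cubeSurface : Set E3 := frontier cube

/-- The point reflection `ι(x,y,z) = (1-x,1-y,1-z)`. -/
def iota (x : E3) : E3 := !₂[1 - x 0, 1 - x 1, 1 - x 2]

/-- The vertices of the cube. -/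
def cubeVertices : Set E3 := {v | ∀ i, v i = 0 ∨ v i = 1}

/-- The union of the two (closed) diagonals of the facet `{x ∈ [0,1]³ | x i = c}`,
for `c = 0` or `c = 1`: the segments between two vertices of the facet that are opposite to each
other in it, that is, differ in both of the other coordinates. -/
def facetDiagonals (i : Fin 3) (c : ℝ) : Set E3 :=
  {x | ∃ v ∈ cubeVertices, ∃ w ∈ cubeVertices,
    v i = c ∧ w i = c ∧ (∀ j, j ≠ i → v j ≠ w j) ∧ x ∈ segment ℝ v w}

end FarthestPoint

/-!
The symmetries of the cube reduce the study of the farthest point map to the points `p = (a, b, 0)`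
with `0 ≤ b ≤ a ≤ 1 / 2`. Let `X = nextCoord a b` be the maximum of the two fractions, so that
`q = (1 - X, 1 - b, 1)` is the claimed farthest point, and let `√S` be the length of the segments
from `p` to `q` in the unfoldings of the bottom, one of the faces `y = 0`, `y = 1`, and the top;
thus `S = 4 + (1 - a - X) ^ 2`.

The distance from `p` to `q` is at least `√S` (`sqrt_farDistSq_le`). A path enters the top through
one of the side faces. On the bottom and the side faces the least length of a few unfolded segments
is a function that is `1`-Lipschitz on each face and consistent along the edges below the top, hence
grows along a path by at most its length (`edist_le_eVariationOn_of_cover`). By the triangle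
inequality in the plane, it suffices to compare `S` with the twelve squared lengths of the segments
from `p` to `q` in the unfoldings that pass through one or two side faces
(`sqrt_le_intrinsicDist_top`).

Every other point is at distance less than `√S` from `p` (`intrinsicDist_lt`), except that for
`a = 1 / 2` the mirror image of `q` must be allowed. Explicit paths bound the distance by the length
of a segment in an unfolding, also where that segment leaves the unfolding, because another one is
shorter in that case (`distSqLE_side_side_top`). Four unfoldings suffice on the half of the top
that contains `q` (`exists_lt_farDistSq`): `X` is the smallest `x` such that for the point
`(1 - x, 1 - b, 1)` the segments in the two unfoldings that define `S` are no longer than those in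
the other two. On the other half the mirror images of the same unfoldings give segments that are no
longer, and are shorter if `a < 1 / 2`. On the side faces the bounds for a point of the top edge
hold strictly for the points below it.

So in the fundamental domain the farthest point map is `(a, b) ↦ (X, b)`. Here `b ≤ X ≤ a`, and
`X - b` is at most `a - b` times a factor that depends only on `b` and is less than `1` if
`b < 1 / 2`, so the iterates tend to `(b, b)`. The points `(b, b, 0)` and their images under the
symmetries form the diagonals of the facets, a closed set, which therefore contains all accumulation
points of orbits. Conversely, such a point and its point reflection are farthest points of each
other (`subset_limitSet`).
-/

namespace FarthestPoint

/-! ### Lengths of paths -/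

theorem intrinsicDist_triangle (M : Set E3) (p q r : E3) :
    intrinsicDist M p r ≤ intrinsicDist M p q + intrinsicDist M q r := by
  simp only [intrinsicDist, ENNReal.iInf_add, ENNReal.add_iInf]
  refine le_iInf₂ fun δ hδ => le_iInf₂ fun γ hγ => ?_
  obtain ⟨hγc, hγm, hγ0, hγ1⟩ := hγ
  obtain ⟨hδc, hδm, hδ0, hδ1⟩ := hδ
  let η : ℝ → E3 := fun t => if t ≤ 1 / 2 then γ (2 * t) else δ (2 * t - 1)
  have e1 : EqOn η (γ ∘ fun t => 2 * t) (Icc 0 (1 / 2)) := fun t ht => if_pos ht.2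
  have e2 : EqOn η (δ ∘ fun t => 2 * t - 1) (Icc (1 / 2) 1) := by
    intro t ht
    rcases ht.1.eq_or_lt with h | h
    · simp [η, ← h, hγ1, hδ0]
    · exact if_neg h.not_ge
  have m1 : MapsTo (fun t : ℝ => 2 * t) (Icc 0 (1 / 2)) (Icc 0 1) := fun t ht =>
    ⟨by linarith [ht.1], by linarith [ht.2]⟩
  have m2 : MapsTo (fun t : ℝ => 2 * t - 1) (Icc (1 / 2) 1) (Icc 0 1) := fun t ht =>
    ⟨by linarith [ht.1], by linarith [ht.2]⟩
  have hu : Icc (0 : ℝ) (1 / 2) ∪ Icc (1 / 2) 1 = Icc 0 1 :=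
    Icc_union_Icc_eq_Icc (by norm_num) (by norm_num)
  have c1 : ContinuousOn η (Icc 0 (1 / 2)) :=
    (hγc.comp (by fun_prop) m1).congr e1
  have c2 : ContinuousOn η (Icc (1 / 2) 1) :=
    (hδc.comp (by fun_prop) m2).congr e2
  have hη : η ∈ pathsIn M p r := by
    refine ⟨?_, ?_, by simp [η, hγ0], ?_⟩
    rotate_left 2
    · norm_num [η, hδ1]
    · rw [← hu]
      exact c1.union_of_isClosed c2 isClosed_Icc isClosed_Icc
    · rw [← hu]
      rintro t (ht | ht)
      · rw [e1 ht]; exact hγm (m1 ht)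
      · rw [e2 ht]; exact hδm (m2 ht)
  refine (iInf₂_le η hη).trans ?_
  have hs := eVariationOn.Icc_add_Icc η (s := univ) (a := 0) (b := 1 / 2) (c := 1)
    (by norm_num) (by norm_num) (mem_univ _)
  simp only [univ_inter] at hs
  rw [← hs]
  refine add_le_add ?_ ?_
  · rw [eVariationOn.eq_of_eqOn e1]
    exact eVariationOn.comp_le_of_monotoneOn _ _ (fun x _ y _ h => by linarith) m1
  · rw [eVariationOn.eq_of_eqOn e2]
    exact eVariationOn.comp_le_of_monotoneOn _ _ (fun x _ y _ h => by linarith) m2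

theorem intrinsicDist_le_edist {M : Set E3} {p q : E3} (h : segment ℝ p q ⊆ M) :
    intrinsicDist M p q ≤ edist p q := by
  have hl : LipschitzWith (nndist p q) (AffineMap.lineMap p q : ℝ → E3) :=
    LipschitzWith.of_dist_le_mul fun s t => by
      rw [dist_lineMap_lineMap, mul_comm, coe_nndist]
  have hm : (AffineMap.lineMap p q : ℝ → E3) ∈ pathsIn M p q := by
    refine ⟨hl.continuous.continuousOn, fun t ht => h ?_, by simp, by simp⟩
    rw [segment_eq_image_lineMap]
    exact mem_image_of_mem _ ht
  refine (iInf₂_le _ hm).trans ?_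
  have h1 := (hl.lipschitzOnWith (s := univ)).comp_eVariationOn_le
    (g := (id : ℝ → ℝ)) (s := Icc (0 : ℝ) 1) (mapsTo_univ _ _)
  have h2 : eVariationOn (id : ℝ → ℝ) (Icc 0 1) ≤ 1 := by
    have := (monotoneOn_id (s := Icc (0 : ℝ) 1)).eVariationOn_eq
      (left_mem_Icc.2 zero_le_one) (right_mem_Icc.2 zero_le_one)
    rw [inter_self] at this
    simp [this]
  calc _ ≤ _ := h1
    _ ≤ (nndist p q : ENNReal) * 1 := by gcongr
    _ = edist p q := by rw [mul_one, edist_nndist]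

theorem intrinsicDist_map_le {M : Set E3} {T : E3 → E3} (hT : Isometry T) (hM : MapsTo T M M)
    (p q : E3) : intrinsicDist M (T p) (T q) ≤ intrinsicDist M p q := by
  refine le_iInf₂ fun γ hγ => ?_
  obtain ⟨hc, hm, h0, h1⟩ := hγ
  have h : T ∘ γ ∈ pathsIn M (T p) (T q) :=
    ⟨hT.continuous.comp_continuousOn hc, hM.comp hm, by simp [h0], by simp [h1]⟩
  refine (iInf₂_le _ h).trans ?_
  simpa using (hT.lipschitz.lipschitzOnWith (s := univ)).comp_eVariationOn_le
    (g := γ) (s := Icc (0 : ℝ) 1) (mapsTo_univ _ _)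

/-- A path through finitely many closed sets `C i` is at least as long as the change along it of a
function that is `1`-Lipschitz on each piece, given by `F i` on `C i`. The path may change from one
piece to another infinitely often; it is cut at the last time at which it is in its first piece,
and from then on it needs one piece less. -/
theorem edist_le_eVariationOn_of_cover {ι : Type*} {C : ι → Set E3} {F : ι → E3 → ℝ}
    (hC : ∀ i, IsClosed (C i)) (hF : ∀ i, LipschitzOnWith 1 (F i) (C i))
    (hag : ∀ i j x, x ∈ C i → x ∈ C j → F i x = F j x) {γ : ℝ → E3} {t : ℝ} (S : Finset ι) :
    ∀ {s : ℝ}, s ≤ t → ContinuousOn γ (Icc s t) → (∀ r ∈ Icc s t, ∃ i ∈ S, γ r ∈ C i) →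
      ∀ i j, γ s ∈ C i → γ t ∈ C j →
        edist (F i (γ s)) (F j (γ t)) ≤ eVariationOn γ (Icc s t) := by
  classical
  induction S using Finset.strongInduction with
  | H S ih =>
    intro s hst hγ hS i j hi hj
    obtain ⟨k, hkS, hk⟩ := hS s (left_mem_Icc.2 hst)
    rw [hag i k _ hi hk]
    have hcl : IsClosed (Icc s t ∩ γ ⁻¹' C k) :=
      hγ.preimage_isClosed_of_isClosed isClosed_Icc (hC k)
    obtain ⟨m, ⟨hm, hmk⟩, hmax⟩ := (isCompact_Icc.of_isClosed_subset hcl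
      inter_subset_left).exists_isGreatest ⟨s, left_mem_Icc.2 hst, hk⟩
    have hsub : Icc m t ⊆ Icc s t := Icc_subset_Icc_left hm.1
    have h1 : edist (F k (γ s)) (F k (γ m)) ≤ eVariationOn γ (Icc s m) := by
      refine ((hF k) hk hmk).trans ?_
      simp only [ENNReal.coe_one, one_mul]
      exact eVariationOn.edist_le γ (left_mem_Icc.2 hm.1) (right_mem_Icc.2 hm.1)
    have h2 : edist (F k (γ m)) (F j (γ t)) ≤ eVariationOn γ (Icc m t) := by
      rcases hm.2.eq_or_lt with h | h
      · subst h
        simp [hag k j _ hmk hj]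
      have hS' : ∀ r ∈ Ioc m t, γ r ∈ ⋃ l ∈ S.erase k, C l := by
        intro r hr
        obtain ⟨l, hl, hlr⟩ := hS r (hsub (Ioc_subset_Icc_self hr))
        refine mem_iUnion₂.2 ⟨l, Finset.mem_erase.2 ⟨?_, hl⟩, hlr⟩
        rintro rfl
        exact (hmax ⟨hsub (Ioc_subset_Icc_self hr), hlr⟩).not_gt hr.1
      have hclosed : IsClosed (⋃ l ∈ S.erase k, C l) :=
        (S.erase k).finite_toSet.isClosed_biUnion fun l _ => hC l
      have hmem : γ m ∈ ⋃ l ∈ S.erase k, C l := by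
        have hcw : ContinuousWithinAt γ (Ioc m t) m :=
          (hγ m hm).mono (Ioc_subset_Icc_self.trans hsub)
        have := hcw.mem_closure (by rw [closure_Ioc h.ne]; exact left_mem_Icc.2 h.le) hS'
        rwa [hclosed.closure_eq] at this
      refine ih (S.erase k) (Finset.erase_ssubset hkS) hm.2 (hγ.mono hsub) (fun r hr => ?_)
        k j hmk hj
      have : γ r ∈ ⋃ l ∈ S.erase k, C l := by
        rcases hr.1.eq_or_lt with h' | h'
        · rwa [← h']
        · exact hS' r ⟨h', hr.2⟩
      simpa using this
    have hs := eVariationOn.Icc_add_Icc γ (s := univ) hm.1 hm.2 (mem_univ _)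
    simp only [univ_inter] at hs
    rw [← hs]
    exact (edist_triangle _ _ _).trans (add_le_add h1 h2)

/-! ### The surface of the cube and its symmetries -/

theorem mem_cubeSurface {x : E3} :
    x ∈ cubeSurface ↔ (∀ i, x i ∈ Icc (0 : ℝ) 1) ∧ ∃ i, x i = 0 ∨ x i = 1 := by
  have h1 : cube = (PiLp.homeomorph 2 (fun _ : Fin 3 => ℝ)) ⁻¹'
      (univ.pi fun _ => Icc (0 : ℝ) 1) := by
    ext x; rw [mem_preimage, mem_univ_pi]; rfl
  have hcl : IsClosed (univ.pi fun _ : Fin 3 => Icc (0 : ℝ) 1) :=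
    isClosed_set_pi fun _ _ => isClosed_Icc
  rw [cubeSurface, h1, ← Homeomorph.preimage_frontier, hcl.frontier_eq,
    interior_pi_set finite_univ]
  simp only [interior_Icc, mem_preimage, Set.mem_sdiff, mem_univ_pi]
  refine and_congr_right fun h => ?_
  rw [not_forall]
  refine exists_congr fun i => ?_
  have := h i
  constructor
  · intro h2
    by_contra! h3
    exact h2 ⟨lt_of_le_of_ne this.1 (Ne.symm h3.1), lt_of_le_of_ne this.2 h3.2⟩
  · rintro (h2 | h2) h3
    · exact h3.1.ne' h2
    · exact h3.2.ne h2

theorem mk_mem_cubeSurface {x y z : ℝ} : (!₂[x, y, z] : E3) ∈ cubeSurface ↔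
    (x ∈ Icc (0 : ℝ) 1 ∧ y ∈ Icc (0 : ℝ) 1 ∧ z ∈ Icc (0 : ℝ) 1) ∧
      ((x = 0 ∨ x = 1) ∨ (y = 0 ∨ y = 1) ∨ (z = 0 ∨ z = 1)) := by
  rw [mem_cubeSurface]
  simp [Fin.forall_fin_succ, Fin.exists_fin_succ]

theorem eq_mk (x : E3) : x = !₂[x 0, x 1, x 2] := by
  ext i; fin_cases i <;> rfl

theorem edist_eq_sqrt (x y : E3) : edist x y =
    ENNReal.ofReal √((x 0 - y 0) ^ 2 + (x 1 - y 1) ^ 2 + (x 2 - y 2) ^ 2) := by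
  rw [edist_dist, EuclideanSpace.dist_eq, Fin.sum_univ_three]
  simp [Real.dist_eq, sq_abs]

/-- The symmetry of the cube that permutes the coordinates by `σ` and then reflects, by
`t ↦ 1 - t`, those with `ε i = true`. -/
def cubeSym (σ : Equiv.Perm (Fin 3)) (ε : Fin 3 → Bool) (x : E3) : E3 :=
  WithLp.toLp 2 fun i => if ε i then 1 - x (σ i) else x (σ i)

theorem cubeSym_apply (σ : Equiv.Perm (Fin 3)) (ε : Fin 3 → Bool) (x : E3) (i : Fin 3) :
    cubeSym σ ε x i = if ε i then 1 - x (σ i) else x (σ i) := rfl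

theorem isometry_cubeSym (σ : Equiv.Perm (Fin 3)) (ε : Fin 3 → Bool) :
    Isometry (cubeSym σ ε) := by
  refine Isometry.of_dist_eq fun x y => ?_
  rw [EuclideanSpace.dist_eq, EuclideanSpace.dist_eq,
    ← Equiv.sum_comp σ fun i => dist (x i) (y i) ^ 2]
  congr 1
  refine Finset.sum_congr rfl fun i _ => ?_
  rw [cubeSym_apply, cubeSym_apply, Real.dist_eq, Real.dist_eq, sq_abs, sq_abs]
  split_ifs <;> ring

theorem cubeSym_mem (σ : Equiv.Perm (Fin 3)) (ε : Fin 3 → Bool) :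
    MapsTo (cubeSym σ ε) cubeSurface cubeSurface := by
  intro x hx
  rw [mem_cubeSurface] at hx ⊢
  obtain ⟨h, i, hi⟩ := hx
  refine ⟨fun j => ?_, σ.symm i, ?_⟩
  · rw [cubeSym_apply]
    have := h (σ j)
    split_ifs
    · exact ⟨by linarith [this.2], by linarith [this.1]⟩
    · exact this
  · rw [cubeSym_apply, Equiv.apply_symm_apply]
    rcases hi with hi | hi <;> rw [hi] <;> split_ifs <;> simp

theorem cubeSym_cubeSym (σ τ : Equiv.Perm (Fin 3)) (ε δ : Fin 3 → Bool) (x : E3) :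
    cubeSym σ ε (cubeSym τ δ x) = cubeSym (τ * σ) (fun i => xor (ε i) (δ (σ i))) x := by
  ext i
  simp only [cubeSym_apply, Equiv.Perm.mul_apply]
  cases ε i <;> cases δ (σ i) <;> simp

theorem cubeSym_symm_apply (σ : Equiv.Perm (Fin 3)) (ε : Fin 3 → Bool) (x : E3) :
    cubeSym σ.symm (fun i => ε (σ.symm i)) (cubeSym σ ε x) = x := by
  ext i
  simp only [cubeSym_apply, Equiv.apply_symm_apply]
  cases ε (σ.symm i) <;> simp

theorem cubeSym_apply_symm (σ : Equiv.Perm (Fin 3)) (ε : Fin 3 → Bool) (x : E3) :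
    cubeSym σ ε (cubeSym σ.symm (fun i => ε (σ.symm i)) x) = x := by
  ext i
  simp only [cubeSym_apply, Equiv.symm_apply_apply]
  cases ε i <;> simp

theorem intrinsicDist_cubeSym (σ : Equiv.Perm (Fin 3)) (ε : Fin 3 → Bool) (p q : E3) :
    intrinsicDist cubeSurface (cubeSym σ ε p) (cubeSym σ ε q) = intrinsicDist cubeSurface p q := by
  refine le_antisymm (intrinsicDist_map_le (isometry_cubeSym σ ε) (cubeSym_mem σ ε) p q) ?_
  have := intrinsicDist_map_le (isometry_cubeSym σ.symm fun i => ε (σ.symm i))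
    (cubeSym_mem σ.symm fun i => ε (σ.symm i)) (cubeSym σ ε p) (cubeSym σ ε q)
  rwa [cubeSym_symm_apply, cubeSym_symm_apply] at this

/-- The farthest point map commutes with the symmetries of the cube. -/
theorem cubeSym_mem_farthest {σ : Equiv.Perm (Fin 3)} {ε : Fin 3 → Bool} {p q : E3} :
    cubeSym σ ε q ∈ farthest cubeSurface (cubeSym σ ε p) ↔ q ∈ farthest cubeSurface p := by
  constructor
  · rintro ⟨hq, h⟩
    refine ⟨by simpa [cubeSym_symm_apply] using
      cubeSym_mem σ.symm (fun i => ε (σ.symm i)) hq, fun r hr => ?_⟩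
    simpa only [intrinsicDist_cubeSym] using h _ (cubeSym_mem σ ε hr)
  · rintro ⟨hq, h⟩
    refine ⟨cubeSym_mem σ ε hq, fun r hr => ?_⟩
    have := h _ (cubeSym_mem σ.symm (fun i => ε (σ.symm i)) hr)
    rwa [← intrinsicDist_cubeSym σ ε, cubeSym_apply_symm, ← intrinsicDist_cubeSym σ ε p] at this

/-! ### Upper bounds from unfoldings -/

/-- The intrinsic distance of `p` and `q` on the surface of the cube is at most `√S`. Upper bounds
are stated through the square, which is a polynomial for the length of a straight segment in an
unfolding. -/
def DistSqLE (p q : E3) (S : ℝ) : Prop :=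
  intrinsicDist cubeSurface p q ≤ ENNReal.ofReal √S

theorem DistSqLE.mono {p q : E3} {S S' : ℝ} (h : DistSqLE p q S) (hS : S ≤ S') :
    DistSqLE p q S' :=
  h.trans (ENNReal.ofReal_le_ofReal (Real.sqrt_le_sqrt hS))

theorem DistSqLE.map {p q : E3} {S : ℝ} (h : DistSqLE p q S) (σ : Equiv.Perm (Fin 3))
    (ε : Fin 3 → Bool) : DistSqLE (cubeSym σ ε p) (cubeSym σ ε q) S := by
  rwa [DistSqLE, intrinsicDist_cubeSym]

theorem DistSqLE.swap01 {x y z u v w S : ℝ} (h : DistSqLE !₂[x, y, z] !₂[u, v, w] S) :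
    DistSqLE !₂[y, x, z] !₂[v, u, w] S := by
  convert h.map (Equiv.swap 0 1) fun _ => false using 1 <;> ext i <;> fin_cases i <;> rfl

theorem DistSqLE.swap02 {x y z u v w S : ℝ} (h : DistSqLE !₂[x, y, z] !₂[u, v, w] S) :
    DistSqLE !₂[z, y, x] !₂[w, v, u] S := by
  convert h.map (Equiv.swap 0 2) fun _ => false using 1 <;> ext i <;> fin_cases i <;> rfl

theorem DistSqLE.swap12 {x y z u v w S : ℝ} (h : DistSqLE !₂[x, y, z] !₂[u, v, w] S) :
    DistSqLE !₂[x, z, y] !₂[u, w, v] S :=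
  h.swap01.swap02.swap01

theorem DistSqLE.flip0 {x y z u v w S : ℝ} (h : DistSqLE !₂[x, y, z] !₂[u, v, w] S) :
    DistSqLE !₂[1 - x, y, z] !₂[1 - u, v, w] S := by
  convert h.map 1 fun i => decide (i = 0) using 1 <;> ext i <;> fin_cases i <;> rfl

theorem DistSqLE.flip1 {x y z u v w S : ℝ} (h : DistSqLE !₂[x, y, z] !₂[u, v, w] S) :
    DistSqLE !₂[x, 1 - y, z] !₂[u, 1 - v, w] S :=
  h.swap01.flip0.swap01

theorem DistSqLE.of_face {x y z u v w : ℝ} (hp : (!₂[x, y, z] : E3) ∈ cubeSurface)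
    (hq : (!₂[u, v, w] : E3) ∈ cubeSurface)
    (h : (x = u ∧ (x = 0 ∨ x = 1)) ∨ (y = v ∧ (y = 0 ∨ y = 1)) ∨ (z = w ∧ (z = 0 ∨ z = 1))) :
    DistSqLE !₂[x, y, z] !₂[u, v, w] ((x - u) ^ 2 + (y - v) ^ 2 + (z - w) ^ 2) := by
  have := intrinsicDist_le_edist (M := cubeSurface) (p := !₂[x, y, z]) (q := !₂[u, v, w]) ?_
  · rw [edist_eq_sqrt] at this
    simpa [DistSqLE] using this
  rintro _ ⟨s, t, hs, ht, hst, rfl⟩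
  obtain ⟨⟨hx, hy, hz⟩, -⟩ := mk_mem_cubeSurface.1 hp
  obtain ⟨⟨hu, hv, hw⟩, -⟩ := mk_mem_cubeSurface.1 hq
  have e : s • (!₂[x, y, z] : E3) + t • !₂[u, v, w] =
      !₂[s * x + t * u, s * y + t * v, s * z + t * w] := by
    ext i; fin_cases i <;> simp
  have hc : ∀ {r r' : ℝ}, r ∈ Icc (0 : ℝ) 1 → r' ∈ Icc (0 : ℝ) 1 → s * r + t * r' ∈ Icc (0 : ℝ) 1 :=
    fun h h' => by simpa using (convex_Icc (0 : ℝ) 1) h h' hs ht hst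
  have hd : ∀ {r r' : ℝ}, r = r' ∧ (r = 0 ∨ r = 1) → s * r + t * r' = 0 ∨ s * r + t * r' = 1 := by
    rintro r _ ⟨rfl, rfl | rfl⟩ <;> simp [hst]
  rw [e, mk_mem_cubeSurface]
  exact ⟨⟨hc hx hu, hc hy hv, hc hz hw⟩, h.imp hd (Or.imp hd hd)⟩

/-- A path that follows a segment of an unfolding, of squared length `S`, may be cut at the point
of the segment with parameter `t`. -/
theorem DistSqLE.split {p e q : E3} {S t : ℝ} (ht : t ∈ Icc (0 : ℝ) 1)
    (h1 : DistSqLE p e (t ^ 2 * S)) (h2 : DistSqLE e q ((1 - t) ^ 2 * S)) : DistSqLE p q S := by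
  rw [DistSqLE, Real.sqrt_mul (sq_nonneg _), Real.sqrt_sq ht.1] at h1
  rw [DistSqLE, Real.sqrt_mul (sq_nonneg _), Real.sqrt_sq (by linarith [ht.2])] at h2
  refine (intrinsicDist_triangle _ p e q).trans ((add_le_add h1 h2).trans ?_)
  rw [← ENNReal.ofReal_add (mul_nonneg ht.1 (Real.sqrt_nonneg _))
    (mul_nonneg (by linarith [ht.2]) (Real.sqrt_nonneg _))]
  exact ENNReal.ofReal_le_ofReal (by linarith)

theorem div_mem_Icc {r s : ℝ} (hr : 0 ≤ r) (hs : r ≤ s) : r / s ∈ Icc (0 : ℝ) 1 :=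
  ⟨div_nonneg hr (hr.trans hs), div_le_one_of_le₀ hs (hr.trans hs)⟩

theorem add_mul_sub_mem_Icc {r s t : ℝ} (hr : r ∈ Icc (0 : ℝ) 1) (hs : s ∈ Icc (0 : ℝ) 1)
    (ht : t ∈ Icc (0 : ℝ) 1) : r + t * (s - r) ∈ Icc (0 : ℝ) 1 := by
  have := (convex_Icc (0 : ℝ) 1) hr hs (sub_nonneg.2 ht.2) ht.1 (by ring)
  simp only [smul_eq_mul] at this
  convert this using 1
  ring

theorem one_sub_mem_Icc {r : ℝ} (hr : r ∈ Icc (0 : ℝ) 1) : 1 - r ∈ Icc (0 : ℝ) 1 :=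
  ⟨by linarith [hr.2], by linarith [hr.1]⟩

section Unfolding
variable {a b u v y z : ℝ}

/-- The unfolding of the bottom and the face `x = 1`. The segment is cut at the common edge, which
it meets at the parameter `(1 - a) / (1 - a + z)`. -/
theorem distSqLE_side (ha : a ∈ Icc (0 : ℝ) 1) (hb : b ∈ Icc (0 : ℝ) 1) (hy : y ∈ Icc (0 : ℝ) 1)
    (hz : z ∈ Icc (0 : ℝ) 1) :
    DistSqLE !₂[a, b, 0] !₂[1, y, z] ((1 - a + z) ^ 2 + (y - b) ^ 2) := by
  have h01 := left_mem_Icc.2 (zero_le_one (α := ℝ))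
  have h11 := right_mem_Icc.2 (zero_le_one (α := ℝ))
  have hp : (!₂[a, b, 0] : E3) ∈ cubeSurface := mk_mem_cubeSurface.2 ⟨⟨ha, hb, h01⟩, by simp⟩
  have hq : (!₂[1, y, z] : E3) ∈ cubeSurface := mk_mem_cubeSurface.2 ⟨⟨h11, hy, hz⟩, by simp⟩
  rcases (add_nonneg (sub_nonneg.2 ha.2) hz.1).eq_or_lt with h | h
  · have hz0 : z = 0 := by linarith [ha.2, hz.1]
    subst hz0
    refine (DistSqLE.of_face hp hq (by simp)).mono (le_of_eq ?_)
    ring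
  · have ht := div_mem_Icc (sub_nonneg.2 ha.2) (show 1 - a ≤ 1 - a + z by linarith [hz.1])
    have hte : (1 - a) / (1 - a + z) * (1 - a + z) = 1 - a := by field_simp
    generalize (1 - a) / (1 - a + z) = t at ht hte
    have he : (!₂[1, b + t * (y - b), 0] : E3) ∈ cubeSurface :=
      mk_mem_cubeSurface.2 ⟨⟨h11, add_mul_sub_mem_Icc hb hy ht, h01⟩, by simp⟩
    refine DistSqLE.split ht ((DistSqLE.of_face hp he (by simp)).mono (le_of_eq ?_))
      ((DistSqLE.of_face he hq (by simp)).mono (le_of_eq ?_))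
    · linear_combination -(t * (1 - a + z) + (1 - a)) * hte
    · linear_combination -(t * (1 - a + z) + (1 - a) - 2 * (1 - a + z)) * hte

/-- The unfolding of the face `x = 1` and the top. -/
theorem distSqLE_side_top (hy : y ∈ Icc (0 : ℝ) 1) (hz : z ∈ Icc (0 : ℝ) 1)
    (hu : u ∈ Icc (0 : ℝ) 1) (hv : v ∈ Icc (0 : ℝ) 1) :
    DistSqLE !₂[1, y, z] !₂[u, v, 1] ((1 - z + (1 - u)) ^ 2 + (v - y) ^ 2) := by
  have := (distSqLE_side hz hy hv (one_sub_mem_Icc hu)).swap02.flip0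
  simpa using this

/-- The unfolding of the bottom, the face `x = 1` and the top, which is a rectangle. -/
theorem distSqLE_top (ha : a ∈ Icc (0 : ℝ) 1) (hb : b ∈ Icc (0 : ℝ) 1) (hu : u ∈ Icc (0 : ℝ) 1)
    (hv : v ∈ Icc (0 : ℝ) 1) :
    DistSqLE !₂[a, b, 0] !₂[u, v, 1] ((3 - a - u) ^ 2 + (v - b) ^ 2) := by
  have h01 := left_mem_Icc.2 (zero_le_one (α := ℝ))
  have h11 := right_mem_Icc.2 (zero_le_one (α := ℝ))
  have hp : (!₂[a, b, 0] : E3) ∈ cubeSurface := mk_mem_cubeSurface.2 ⟨⟨ha, hb, h01⟩, by simp⟩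
  have hpos : 0 < 3 - a - u := by linarith [ha.2, hu.2]
  have ht := div_mem_Icc (sub_nonneg.2 ha.2) (show 1 - a ≤ 3 - a - u by linarith [hu.2])
  have hte : (1 - a) / (3 - a - u) * (3 - a - u) = 1 - a := by field_simp
  generalize (1 - a) / (3 - a - u) = t at ht hte
  have hm := add_mul_sub_mem_Icc hb hv ht
  have he : (!₂[1, b + t * (v - b), 0] : E3) ∈ cubeSurface :=
    mk_mem_cubeSurface.2 ⟨⟨h11, hm, h01⟩, by simp⟩
  refine DistSqLE.split ht ((DistSqLE.of_face hp he (by simp)).mono (le_of_eq ?_))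
    ((distSqLE_side_top hm h01 hu hv).mono (le_of_eq ?_))
  · linear_combination -(t * (3 - a - u) + (1 - a)) * hte
  · linear_combination -(t * (3 - a - u) + (1 - a) - 2 * (3 - a - u)) * hte

/-- The unfolding of the bottom, the face `y = 0` and the face `x = 1`. If the segment leaves this
non-convex region, it passes on the far side of the common vertex of the three faces, and the
segment in the unfolding of the bottom and the face `x = 1` is shorter. -/
theorem distSqLE_side_side (ha : a ∈ Icc (0 : ℝ) 1) (hb : b ∈ Icc (0 : ℝ) 1)
    (hy : y ∈ Icc (0 : ℝ) 1) (hz : z ∈ Icc (0 : ℝ) 1) :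
    DistSqLE !₂[a, b, 0] !₂[1, y, z] ((1 - a + y) ^ 2 + (b + z) ^ 2) := by
  have h01 := left_mem_Icc.2 (zero_le_one (α := ℝ))
  have h11 := right_mem_Icc.2 (zero_le_one (α := ℝ))
  have hp : (!₂[a, b, 0] : E3) ∈ cubeSurface := mk_mem_cubeSurface.2 ⟨⟨ha, hb, h01⟩, by simp⟩
  rcases le_or_gt (b * y) ((1 - a) * z) with h | h
  · rcases (add_nonneg hb.1 hz.1).eq_or_lt with h0 | h0
    · have hb0 : b = 0 := by linarith [hb.1, hz.1]
      have hz0 : z = 0 := by linarith [hb.1, hz.1]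
      subst hb0 hz0
      refine (distSqLE_side ha h01 hy h01).mono ?_
      nlinarith [mul_nonneg (sub_nonneg.2 ha.2) hy.1]
    · have ht := div_mem_Icc hb.1 (show b ≤ b + z by linarith [hz.1])
      have hx : a + b / (b + z) * (1 - a + y) ∈ Icc (0 : ℝ) 1 := by
        refine ⟨add_nonneg ha.1 (mul_nonneg ht.1 (by linarith [ha.2, hy.1])), ?_⟩
        rw [← le_sub_iff_add_le', div_mul_eq_mul_div, div_le_iff₀ h0]
        linarith
      have hte : b / (b + z) * (b + z) = b := by field_simp
      generalize b / (b + z) = t at ht hte hx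
      have he : (!₂[a + t * (1 - a + y), 0, 0] : E3) ∈ cubeSurface :=
        mk_mem_cubeSurface.2 ⟨⟨hx, h01, h01⟩, by simp⟩
      refine DistSqLE.split ht ((DistSqLE.of_face hp he (by simp)).mono (le_of_eq ?_))
        ((distSqLE_side hx h01 hz hy).swap12.mono (le_of_eq ?_))
      · linear_combination -(t * (b + z) + b) * hte
      · linear_combination -(t * (b + z) + b - 2 * (b + z)) * hte
  · refine (distSqLE_side ha hb hy hz).mono ?_
    nlinarith [mul_nonneg (sub_nonneg.2 ha.2) hy.1, mul_nonneg hb.1 hz.1]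

/-- The unfolding of the bottom, the face `y = 0`, the face `x = 1` and the top. If the segment
passes beyond the first common vertex, the unfolding of `distSqLE_top` is shorter. -/
theorem distSqLE_side_side_top (ha : a ∈ Icc (0 : ℝ) 1) (hb : b ∈ Icc (0 : ℝ) 1)
    (hu : u ∈ Icc (0 : ℝ) 1) (hv : v ∈ Icc (0 : ℝ) 1) :
    DistSqLE !₂[a, b, 0] !₂[u, v, 1] ((1 - a + v) ^ 2 + (2 - u + b) ^ 2) := by
  have h01 := left_mem_Icc.2 (zero_le_one (α := ℝ))
  have hp : (!₂[a, b, 0] : E3) ∈ cubeSurface := mk_mem_cubeSurface.2 ⟨⟨ha, hb, h01⟩, by simp⟩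
  have h0 : 0 < 2 - u + b := by linarith [hu.2, hb.1]
  rcases le_or_gt (b * v) ((1 - a) * (2 - u)) with h | h
  · have ht := div_mem_Icc hb.1 (show b ≤ 2 - u + b by linarith [hu.2])
    have hx : a + b / (2 - u + b) * (1 - a + v) ∈ Icc (0 : ℝ) 1 := by
      refine ⟨add_nonneg ha.1 (mul_nonneg ht.1 (by linarith [ha.2, hv.1])), ?_⟩
      rw [← le_sub_iff_add_le', div_mul_eq_mul_div, div_le_iff₀ h0]
      linarith
    have hte : b / (2 - u + b) * (2 - u + b) = b := by field_simp
    generalize b / (2 - u + b) = t at ht hte hx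
    have he : (!₂[a + t * (1 - a + v), 0, 0] : E3) ∈ cubeSurface :=
      mk_mem_cubeSurface.2 ⟨⟨hx, h01, h01⟩, by simp⟩
    have key := (distSqLE_side_side h01 (one_sub_mem_Icc hx)
      (one_sub_mem_Icc hu) hv).swap01.flip0.swap12
    simp only [sub_sub_cancel, sub_zero] at key
    refine DistSqLE.split ht ((DistSqLE.of_face hp he (by simp)).mono (le_of_eq ?_)) ?_
    · linear_combination -(t * (2 - u + b) + b) * hte
    · refine key.mono (le_of_eq ?_)
      linear_combination -(t * (2 - u + b) + b - 2 * (2 - u + b)) * hte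
  · refine (distSqLE_top ha hb hu hv).mono ?_
    nlinarith [mul_nonneg (sub_nonneg.2 ha.2) hv.1, mul_nonneg hb.1 (sub_nonneg.2 hu.2), hb.1]

end Unfolding

/-! ### Lower bounds for the distance to a point of the top -/

/-- The Euclidean norm of a plane vector with the given coordinates. -/
noncomputable def planeNorm (r s : ℝ) : ℝ := √(r ^ 2 + s ^ 2)

theorem planeNorm_le_planeNorm {r s r' s' : ℝ} (h : r ^ 2 + s ^ 2 ≤ r' ^ 2 + s' ^ 2) :
    planeNorm r s ≤ planeNorm r' s' :=
  Real.sqrt_le_sqrt h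

theorem planeNorm_congr {r s r' s' : ℝ} (h : r ^ 2 + s ^ 2 = r' ^ 2 + s' ^ 2) :
    planeNorm r s = planeNorm r' s' := by
  rw [planeNorm, h, planeNorm]

theorem planeNorm_add_le (r s r' s' : ℝ) :
    planeNorm (r + r') (s + s') ≤ planeNorm r s + planeNorm r' s' := by
  have h : ∀ x y : ℝ, planeNorm x y = ‖(⟨x, y⟩ : ℂ)‖ := fun x y => by
    rw [planeNorm, Complex.norm_eq_sqrt_sq_add_sq]
  rw [h, h, h]
  exact norm_add_le (⟨r, s⟩ : ℂ) ⟨r', s'⟩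

theorem lipschitzWith_planeNorm {i j : Fin 3} (hij : i ≠ j) {f g : ℝ → ℝ}
    (hf : ∀ s t, (f s - f t) ^ 2 = (s - t) ^ 2) (hg : ∀ s t, (g s - g t) ^ 2 = (s - t) ^ 2) :
    LipschitzWith 1 fun x : E3 => planeNorm (f (x i)) (g (x j)) := by
  refine LipschitzWith.of_le_add fun x y => ?_
  have h1 := planeNorm_add_le (f (y i)) (g (y j)) (f (x i) - f (y i)) (g (x j) - g (y j))
  rw [add_sub_cancel, add_sub_cancel] at h1
  refine h1.trans (add_le_add_right ?_ _)
  rw [planeNorm, EuclideanSpace.dist_eq, hf, hg]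
  refine Real.sqrt_le_sqrt ?_
  simp only [Real.dist_eq, sq_abs]
  rw [← Finset.sum_pair (f := fun k => (x k - y k) ^ 2) hij]
  exact Finset.sum_le_sum_of_subset_of_nonneg (Finset.subset_univ _) fun _ _ _ => sq_nonneg _

/-- The least of three distances from a point `p` of the bottom to a point of a side face, in the
unfolding of the bottom and that face and in the two unfoldings that pass through a neighbouring
side face. Here `α` is the distance from `p` to the face, `β` and `w` are the horizontal coordinates
of the two points along the face, and `z` is the height of the second one. -/
noncomputable def sideDist (α β w z : ℝ) : ℝ :=
  min (planeNorm (α + z) (w - β))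
    (min (planeNorm (1 + α - w) (1 - β + z)) (planeNorm (α + w) (β + z)))

theorem sideDist_zero {α β w : ℝ} (hα : α ∈ Icc (0 : ℝ) 1) (hβ : β ∈ Icc (0 : ℝ) 1)
    (hw : w ∈ Icc (0 : ℝ) 1) : sideDist α β w 0 = planeNorm α (w - β) := by
  rw [sideDist, add_zero, min_eq_left]
  refine le_min (planeNorm_le_planeNorm ?_) (planeNorm_le_planeNorm ?_)
  · nlinarith [mul_nonneg hα.1 (sub_nonneg.2 hw.2),
      mul_nonneg (sub_nonneg.2 hβ.2) (sub_nonneg.2 hw.2)]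
  · nlinarith [mul_nonneg hα.1 hw.1, mul_nonneg hβ.1 hw.1]

theorem sideDist_reflect (α β w z : ℝ) : sideDist α β w z = sideDist α (1 - β) (1 - w) z := by
  rw [sideDist, sideDist, min_comm (planeNorm (1 + α - w) _)]
  congr 1
  · exact planeNorm_congr (by ring)
  congr 1 <;> exact planeNorm_congr (by ring)

theorem sideDist_one {α β z : ℝ} (hα : α ∈ Icc (0 : ℝ) 1) (hβ : β ∈ Icc (0 : ℝ) 1)
    (hz : z ∈ Icc (0 : ℝ) 1) : sideDist α β 1 z = sideDist (1 - β) (1 - α) 1 z := by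
  have key : ∀ {α β : ℝ}, α ∈ Icc (0 : ℝ) 1 → β ∈ Icc (0 : ℝ) 1 →
      sideDist α β 1 z = min (planeNorm (α + z) (1 - β)) (planeNorm α (1 - β + z)) := by
    intro α β hα hβ
    rw [sideDist, ← min_assoc, show (1 + α - 1) = α by ring]
    refine min_eq_left (min_le_of_left_le (planeNorm_le_planeNorm ?_))
    nlinarith [mul_nonneg hα.1 (sub_nonneg.2 hz.2), mul_nonneg hβ.1 hz.1, hβ.1]
  rw [key hα hβ, key (one_sub_mem_Icc hβ) (one_sub_mem_Icc hα), min_comm]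
  congr 1 <;> exact planeNorm_congr (by ring)

theorem lipschitzWith_sideDist {i j : Fin 3} (hij : i ≠ j) (α β : ℝ) :
    LipschitzWith 1 fun x : E3 => sideDist α β (x i) (x j) := by
  have h1 : LipschitzWith 1 fun x : E3 => planeNorm (α + x j) (x i - β) :=
    lipschitzWith_planeNorm hij.symm (f := fun t => α + t) (g := fun t => t - β)
      (fun s t => by ring) fun s t => by ring
  have h2 : LipschitzWith 1 fun x : E3 => planeNorm (1 + α - x i) (1 - β + x j) :=
    lipschitzWith_planeNorm hij (f := fun t => 1 + α - t) (g := fun t => 1 - β + t)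
      (fun s t => by ring) fun s t => by ring
  have h3 : LipschitzWith 1 fun x : E3 => planeNorm (α + x i) (β + x j) :=
    lipschitzWith_planeNorm hij (f := fun t => α + t) (g := fun t => β + t)
      (fun s t => by ring) fun s t => by ring
  simpa [sideDist] using h1.min (h2.min h3)

/-- The squares of the distances from `p` to a point of the top, in the three unfoldings in which a
path enters the top through a given side face, are at least `S`. As in `sideDist`, the numbers `α`
and `δ` are the distances of the two points to the face, and `β` and `w` are their coordinates along
it. -/
def LETopUnfoldings (S α β δ w : ℝ) : Prop :=
  S ≤ (α + 1 + δ) ^ 2 + (w - β) ^ 2 ∧ S ≤ (1 + α - w) ^ 2 + (2 - β + δ) ^ 2 ∧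
    S ≤ (α + w) ^ 2 + (β + 1 + δ) ^ 2

theorem LETopUnfoldings.sqrt_le {S α β δ w : ℝ} (h : LETopUnfoldings S α β δ w) (w' : ℝ) :
    √S ≤ sideDist α β w' 1 + planeNorm δ (w - w') := by
  obtain ⟨h1, h2, h3⟩ := h
  rw [sideDist, ← min_add_add_right, ← min_add_add_right]
  refine le_min ?_ (le_min ?_ ?_)
  · refine le_trans ?_ (planeNorm_add_le (α + 1) (w' - β) δ (w - w'))
    exact Real.sqrt_le_sqrt (h1.trans_eq (by ring))
  · rw [planeNorm_congr (show δ ^ 2 + (w - w') ^ 2 = (w' - w) ^ 2 + δ ^ 2 by ring)]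
    refine le_trans ?_ (planeNorm_add_le (1 + α - w') (1 - β + 1) (w' - w) δ)
    exact Real.sqrt_le_sqrt (h2.trans_eq (by ring))
  · rw [planeNorm_congr (show δ ^ 2 + (w - w') ^ 2 = (w - w') ^ 2 + δ ^ 2 by ring)]
    refine le_trans ?_ (planeNorm_add_le (α + w') (β + 1) (w - w') δ)
    exact Real.sqrt_le_sqrt (h3.trans_eq (by ring))

/-- The faces of the cube other than the top. -/
def lowerFace : Fin 5 → Set E3 :=
  ![{x | x ∈ cube ∧ x 2 = 0}, {x | x ∈ cube ∧ x 0 = 1}, {x | x ∈ cube ∧ x 0 = 0},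
    {x | x ∈ cube ∧ x 1 = 1}, {x | x ∈ cube ∧ x 1 = 0}]

/-- On each face other than the top, a lower bound for the distance from the point `(a, b, 0)`. -/
noncomputable def lowerFaceDist (a b : ℝ) : Fin 5 → E3 → ℝ :=
  ![fun x => planeNorm (x 0 - a) (x 1 - b), fun x => sideDist (1 - a) b (x 1) (x 2),
    fun x => sideDist a b (x 1) (x 2), fun x => sideDist (1 - b) a (x 0) (x 2),
    fun x => sideDist b a (x 0) (x 2)]

theorem isClosed_cube : IsClosed cube := by
  simp only [cube, Set.ofPred_forall]
  exact isClosed_iInter fun i => isClosed_Icc.preimage (by fun_prop)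

theorem isClosed_cube_inter (i : Fin 3) (c : ℝ) : IsClosed {x : E3 | x ∈ cube ∧ x i = c} :=
  isClosed_cube.inter (isClosed_eq (by fun_prop) continuous_const)

theorem isClosed_lowerFace (i : Fin 5) : IsClosed (lowerFace i) := by
  fin_cases i <;> exact isClosed_cube_inter _ _

theorem lipschitzWith_lowerFaceDist (a b : ℝ) (i : Fin 5) :
    LipschitzWith 1 (lowerFaceDist a b i) := by
  fin_cases i
  · exact lipschitzWith_planeNorm (i := 0) (j := 1) (by decide) (f := fun t => t - a)
      (g := fun t => t - b) (fun s t => by ring) fun s t => by ring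
  all_goals exact lipschitzWith_sideDist (by decide) _ _

theorem lowerFaceDist_eq {a b : ℝ} (ha : a ∈ Icc (0 : ℝ) 1) (hb : b ∈ Icc (0 : ℝ) 1)
    (i j : Fin 5) (x : E3) (hi : x ∈ lowerFace i) (hj : x ∈ lowerFace j) :
    lowerFaceDist a b i x = lowerFaceDist a b j x := by
  have ha' := one_sub_mem_Icc ha
  have hb' := one_sub_mem_Icc hb
  wlog hij : i < j generalizing i j
  · rcases (not_lt.1 hij).eq_or_lt with h | h
    · rw [h]
    · exact (this j i hj hi h).symm
  have hx : x ∈ cube := by fin_cases i <;> exact hi.1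
  have h0 := hx 0
  have h1 := hx 1
  have h2 := hx 2
  fin_cases i <;> fin_cases j <;> first | exact absurd hij (by decide) | skip
  all_goals
    replace hi := hi.2
    replace hj := hj.2
  · change planeNorm (x 0 - a) (x 1 - b) = sideDist (1 - a) b (x 1) (x 2)
    rw [hi, hj, sideDist_zero ha' hb h1]
  · change planeNorm (x 0 - a) (x 1 - b) = sideDist a b (x 1) (x 2)
    rw [hi, hj, sideDist_zero ha hb h1]
    exact planeNorm_congr (by ring)
  · change planeNorm (x 0 - a) (x 1 - b) = sideDist (1 - b) a (x 0) (x 2)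
    rw [hi, hj, sideDist_zero hb' ha h0]
    exact planeNorm_congr (by ring)
  · change planeNorm (x 0 - a) (x 1 - b) = sideDist b a (x 0) (x 2)
    rw [hi, hj, sideDist_zero hb ha h0]
    exact planeNorm_congr (by ring)
  · exact absurd (hi.symm.trans hj) one_ne_zero
  · change sideDist (1 - a) b (x 1) (x 2) = sideDist (1 - b) a (x 0) (x 2)
    rw [hi, hj, sideDist_one ha' hb h2, sub_sub_cancel]
  · change sideDist (1 - a) b (x 1) (x 2) = sideDist b a (x 0) (x 2)
    rw [hi, hj, sideDist_one hb ha h2, sideDist_reflect, sub_zero]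
  · change sideDist a b (x 1) (x 2) = sideDist (1 - b) a (x 0) (x 2)
    rw [hi, hj, sideDist_one ha hb h2, sideDist_reflect, sub_sub_cancel, sub_self]
  · change sideDist a b (x 1) (x 2) = sideDist b a (x 0) (x 2)
    rw [hi, hj, sideDist_reflect a, sideDist_reflect b, sub_zero, sideDist_one ha hb' h2,
      sub_sub_cancel]
  · exact absurd (hi.symm.trans hj) one_ne_zero

theorem exists_lowerFace {x : E3} (hx : x ∈ cubeSurface) (h : x 2 ≠ 1) : ∃ i, x ∈ lowerFace i := by
  obtain ⟨hc, i, hi⟩ := mem_cubeSurface.1 hx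
  fin_cases i <;> rcases hi with hi | hi
  · exact ⟨2, hc, hi⟩
  · exact ⟨1, hc, hi⟩
  · exact ⟨4, hc, hi⟩
  · exact ⟨3, hc, hi⟩
  · exact ⟨0, hc, hi⟩
  · exact absurd hi h

/-- A point of the top is at distance at least `√S` from a point of the bottom if the twelve
distances in the unfoldings that pass through at most two side faces are. A path is cut at its first
point in the top; the lower bounds `lowerFaceDist` apply to its first part. -/
theorem sqrt_le_intrinsicDist_top {a b u v S : ℝ} (ha : a ∈ Icc (0 : ℝ) 1)
    (hb : b ∈ Icc (0 : ℝ) 1) (h1 : LETopUnfoldings S (1 - a) b (1 - u) v)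
    (h2 : LETopUnfoldings S a b u v) (h3 : LETopUnfoldings S (1 - b) a (1 - v) u)
    (h4 : LETopUnfoldings S b a v u) :
    ENNReal.ofReal √S ≤ intrinsicDist cubeSurface !₂[a, b, 0] !₂[u, v, 1] := by
  refine le_iInf₂ fun γ hγ => ?_
  obtain ⟨hc, hm, h0, he⟩ := hγ
  have hcl : IsClosed (Icc (0 : ℝ) 1 ∩ γ ⁻¹' {x | x ∈ cube ∧ x 2 = 1}) :=
    hc.preimage_isClosed_of_isClosed isClosed_Icc (isClosed_cube_inter 2 1)
  obtain ⟨t, ⟨ht, -, htop⟩, hmin⟩ := (isCompact_Icc.of_isClosed_subset hcl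
    inter_subset_left).exists_isLeast ⟨1, right_mem_Icc.2 zero_le_one,
      (mem_cubeSurface.1 (hm (right_mem_Icc.2 zero_le_one))).1, by simp [he]⟩
  have hsub : Icc 0 t ⊆ Icc (0 : ℝ) 1 := Icc_subset_Icc_right ht.2
  have ht0 : 0 < t := by
    refine ht.1.lt_of_ne ?_
    rintro rfl
    simp [h0] at htop
  have hlow : ∀ r ∈ Ico 0 t, γ r ∈ ⋃ i, lowerFace i := by
    intro r hr
    have hrI := hsub (Ico_subset_Icc_self hr)
    refine mem_iUnion.2 (exists_lowerFace (hm hrI) fun h => ?_)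
    exact (hmin ⟨hrI, (mem_cubeSurface.1 (hm hrI)).1, h⟩).not_gt hr.2
  have hlowt : γ t ∈ ⋃ i, lowerFace i := by
    have hcw : ContinuousWithinAt γ (Ico 0 t) t :=
      (hc t ht).mono (Ico_subset_Icc_self.trans hsub)
    have := hcw.mem_closure (by rw [closure_Ico ht0.ne]; exact right_mem_Icc.2 ht0.le) hlow
    rwa [(isClosed_iUnion_of_finite isClosed_lowerFace).closure_eq] at this
  obtain ⟨i, hi⟩ := mem_iUnion.1 hlowt
  have hp : γ 0 ∈ lowerFace 0 := ⟨(mem_cubeSurface.1 (hm (hsub (left_mem_Icc.2 ht0.le)))).1,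
    by simp [h0]⟩
  have hbelow := edist_le_eVariationOn_of_cover isClosed_lowerFace
    (fun i => (lipschitzWith_lowerFaceDist a b i).lipschitzOnWith (s := lowerFace i))
    (lowerFaceDist_eq ha hb) Finset.univ ht.1 (hc.mono hsub) (fun r hr => ?_) 0 i hp hi
  swap
  · rcases hr.2.eq_or_lt with h | h
    · exact ⟨i, Finset.mem_univ _, h ▸ hi⟩
    · obtain ⟨j, hj⟩ := mem_iUnion.1 (hlow r ⟨hr.1, h⟩)
      exact ⟨j, Finset.mem_univ _, hj⟩
  have habove : edist (γ t) (γ 1) ≤ eVariationOn γ (Icc t 1) :=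
    eVariationOn.edist_le γ (left_mem_Icc.2 ht.2) (right_mem_Icc.2 ht.2)
  have hs := eVariationOn.Icc_add_Icc γ (s := univ) ht.1 ht.2 (mem_univ _)
  simp only [univ_inter] at hs
  rw [← hs]
  refine le_trans ?_ (add_le_add hbelow habove)
  have hF0 : lowerFaceDist a b 0 (γ 0) = 0 := by simp [lowerFaceDist, h0, planeNorm]
  rw [hF0, edist_comm, edist_dist, edist_dist, ← ENNReal.ofReal_add dist_nonneg dist_nonneg,
    Real.dist_eq, sub_zero]
  refine ENNReal.ofReal_le_ofReal (le_trans ?_ (add_le_add_left (le_abs_self _) _))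
  rw [EuclideanSpace.dist_eq, Fin.sum_univ_three, he]
  simp only [Real.dist_eq, sq_abs, htop]
  generalize γ t = e at hi htop
  fin_cases i
  · exact absurd (htop.symm.trans hi.2) one_ne_zero
  · have hi' : e 0 = 1 := hi.2
    refine (h1.sqrt_le (e 1)).trans_eq (congr_arg₂ (· + ·) (congrArg (sideDist _ _ _) htop.symm)
      (congr_arg Real.sqrt ?_))
    simp [hi']
    ring
  · have hi' : e 0 = 0 := hi.2
    refine (h2.sqrt_le (e 1)).trans_eq (congr_arg₂ (· + ·) (congrArg (sideDist _ _ _) htop.symm)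
      (congr_arg Real.sqrt ?_))
    simp [hi']
    ring
  · have hi' : e 1 = 1 := hi.2
    refine (h3.sqrt_le (e 0)).trans_eq (congr_arg₂ (· + ·) (congrArg (sideDist _ _ _) htop.symm)
      (congr_arg Real.sqrt ?_))
    simp [hi']
    ring
  · have hi' : e 1 = 0 := hi.2
    refine (h4.sqrt_le (e 0)).trans_eq (congr_arg₂ (· + ·) (congrArg (sideDist _ _ _) htop.symm)
      (congr_arg Real.sqrt ?_))
    simp [hi']
    ring

/-! ### The farthest points of a point of the fundamental domain -/

/-- For `p = (a, b, 0)` with `0 ≤ b ≤ a ≤ 1 / 2`, the first coordinate of the point reflection of a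
farthest point of `p`. -/
noncomputable def nextCoord (a b : ℝ) : ℝ :=
  max ((a + 2 * b * (1 - b)) / (3 - 2 * a)) ((a + b) * (1 - b) / (2 + b - a))

/-- The square of the distance from `p = (a, b, 0)` to its farthest points. -/
noncomputable def farDistSq (a b : ℝ) : ℝ := 4 + (1 - a - nextCoord a b) ^ 2

section
variable {a b : ℝ}

/-- For the point with `x = nextCoord a b`, `y = b` in `exists_lt_farDistSq`, the segment in the
unfolding through the face `x = 1` is at least as long as those through `y = 0` and `y = 1`. -/
theorem le_nextCoord_mul (ha : a ≤ 1 / 2) : a + 2 * b * (1 - b) ≤ nextCoord a b * (3 - 2 * a) := by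
  rw [← div_le_iff₀ (by linarith)]
  exact le_max_left _ _

/-- The analogue of `le_nextCoord_mul` for the unfolding through the faces `y = 0` and `x = 1`. -/
theorem le_nextCoord_mul' (hb : 0 ≤ b) (ha : a ≤ 1 / 2) :
    (a + b) * (1 - b) ≤ nextCoord a b * (2 + b - a) := by
  rw [← div_le_iff₀ (by linarith)]
  exact le_max_right _ _

theorem nextCoord_cases (hb : 0 ≤ b) (ha : a ≤ 1 / 2) :
    nextCoord a b * (3 - 2 * a) = a + 2 * b * (1 - b) ∨
      nextCoord a b * (2 + b - a) = (a + b) * (1 - b) := by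
  rcases max_choice ((a + 2 * b * (1 - b)) / (3 - 2 * a)) ((a + b) * (1 - b) / (2 + b - a))
    with h | h
  · left
    rw [nextCoord, h, div_mul_cancel₀ _ (by linarith)]
  · right
    rw [nextCoord, h, div_mul_cancel₀ _ (by linarith)]

theorem le_nextCoord (hb : 0 ≤ b) (hba : b ≤ a) (ha : a ≤ 1 / 2) : b ≤ nextCoord a b := by
  refine le_max_of_le_left ((le_div_iff₀ (by linarith)).2 ?_)
  nlinarith [mul_nonneg hb (sub_nonneg.2 hba)]

theorem nextCoord_le (hb : 0 ≤ b) (hba : b ≤ a) (ha : a ≤ 1 / 2) : nextCoord a b ≤ a := by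
  refine max_le ((div_le_iff₀ (by linarith)).2 ?_) ((div_le_iff₀ (by linarith)).2 ?_)
  · nlinarith [mul_nonneg (sub_nonneg.2 hba) (show 0 ≤ 1 - a - b by linarith)]
  · nlinarith [mul_nonneg (sub_nonneg.2 hba) (show 0 ≤ 1 - a + b by linarith), sq_nonneg b]

theorem farDistSq_pos : 0 < farDistSq a b := by
  unfold farDistSq
  positivity

/-- Of the twelve squared distances, those through `y = 0` and through `y = 1` equal `farDistSq`,
and those through `x = 1` and through `y = 0` and `x = 1` are compared with it by the definition of
`nextCoord`. The remaining comparisons follow from these and from `b ≤ nextCoord a b ≤ a`. -/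
theorem sqrt_farDistSq_le (hb : 0 ≤ b) (hba : b ≤ a) (ha : a ≤ 1 / 2) :
    ENNReal.ofReal √(farDistSq a b) ≤
      intrinsicDist cubeSurface !₂[a, b, 0] !₂[1 - nextCoord a b, 1 - b, 1] := by
  have h1 := le_nextCoord_mul (b := b) ha
  have h2 := le_nextCoord_mul' hb ha
  have h3 := le_nextCoord hb hba ha
  have h4 := nextCoord_le hb hba ha
  rw [farDistSq]
  generalize nextCoord a b = x at *
  have hx1 : 0 ≤ a - x := by linarith
  have hx2 : 0 ≤ x - b := by linarith
  have hx3 : 0 ≤ 1 - a - x := by linarith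
  have k1 := mul_nonneg hb hx3
  have k2 := mul_nonneg hx1 hx3
  have k3 := mul_nonneg hb hx1
  have k4 := mul_nonneg (hb.trans hba) hx1
  have k5 := mul_nonneg (hb.trans hba) (show 0 ≤ 1 - a - b by linarith)
  refine sqrt_le_intrinsicDist_top ⟨hb.trans hba, by linarith⟩ ⟨hb, by linarith⟩ ⟨?_, ?_, ?_⟩
    ⟨?_, ?_, ?_⟩ ⟨?_, ?_, ?_⟩ ⟨?_, ?_, ?_⟩ <;> nlinarith

/-- Every point `(1 - x, 1 - y, 1)` of the top with `x ≤ 1 / 2`, other than the claimed one, is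
closer to `p` in one of four unfoldings, which pass through the face `x = 1`, through `y = 0`,
through `y = 1`, and through `y = 0` and `x = 1`. If `x` is too small and two of these distances
were nevertheless large, then `ξ = nextCoord a b - x` and `η = |b - y|` would satisfy inequalities
`η * P ≤ ξ * P'` and `ξ * Q ≤ η * Q'` with `P' < Q` and `Q' ≤ P`. -/
theorem exists_lt_farDistSq (hb : 0 ≤ b) (hba : b ≤ a) (ha : a ≤ 1 / 2) {x y : ℝ} (hx0 : 0 ≤ x)
    (hx : x ≤ 1 / 2) (hy0 : 0 ≤ y) (hy : y ≤ 1) (hne : x ≠ nextCoord a b ∨ y ≠ b) :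
    (2 - a + x) ^ 2 + (1 - b - y) ^ 2 < farDistSq a b ∨
      (2 + b - y) ^ 2 + (1 - a - x) ^ 2 < farDistSq a b ∨
      (2 - b + y) ^ 2 + (1 - a - x) ^ 2 < farDistSq a b ∨
      (2 - a - y) ^ 2 + (1 + b + x) ^ 2 < farDistSq a b := by
  have h0 := nextCoord_cases hb ha
  have h3 := le_nextCoord hb hba ha
  have h4 := nextCoord_le hb hba ha
  rw [farDistSq]
  generalize nextCoord a b = X at *
  by_contra! hcon
  obtain ⟨hD2, hD3, hD4, hG⟩ := hcon
  rcases le_or_gt X x with hxX | hxX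
  · -- `x` is between `X` and its mirror image `2 * (1 - a) - X`, so that `|1 - a - x|` is small.
    have k := mul_nonneg (sub_nonneg.2 hxX) (show 0 ≤ 2 - 2 * a - x - X by linarith)
    rcases lt_trichotomy y b with hyb | hyb | hyb
    · linarith [mul_pos (sub_pos.2 hyb) (show 0 < 4 - (b - y) by linarith)]
    · have hlt : X < x := hxX.lt_of_ne (fun h => hne.elim (fun h' => h' h.symm) fun h' => h' hyb)
      subst hyb
      linarith [mul_pos (sub_pos.2 hlt) (show 0 < 2 - 2 * a - x - X by linarith)]
    · linarith [mul_pos (sub_pos.2 hyb) (show 0 < 4 - (y - b) by linarith)]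
  have hξ := sub_pos.2 hxX
  rcases h0 with h0 | h0
  · -- For `x = X`, `y = b` the distance through the face `x = 1` is also `√(farDistSq a b)`.
    have k := mul_pos hξ (show 0 < (4 - 2 * a + 2 * X - (X - x)) - (2 - 2 * a - 2 * X + (X - x)) by
      linarith)
    rcases le_total y b with hyb | hyb
    · linarith [mul_nonneg (sub_nonneg.2 hyb) (show 0 ≤ 4 - (b - y) - (2 - 4 * b + (b - y)) by
        linarith)]
    · linarith [mul_nonneg (sub_nonneg.2 hyb) (show 0 ≤ 4 - (y - b) - (y - b - 2 + 4 * b) by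
        linarith)]
  · -- For `x = X`, `y = b` the distance through `y = 0` and `x = 1` is also `√(farDistSq a b)`.
    rcases le_total y b with hyb | hyb
    · have k := mul_pos hξ
        (show 0 < (2 + 2 * X + 2 * b - (X - x)) - (2 - 2 * a - 2 * X + (X - x)) by linarith)
      linarith [mul_nonneg (sub_nonneg.2 hyb)
        (show 0 ≤ 4 - (b - y) - (4 - 2 * a - 2 * b + (b - y)) by linarith)]
    · have k := mul_pos hξ (show 0 < 2 + 2 * X + 2 * b - (X - x) by linarith)
      linarith [mul_nonneg (sub_nonneg.2 hyb) (show 0 ≤ 4 - 2 * a - 2 * b - (y - b) by linarith)]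

theorem exists_le_farDistSq (hb : 0 ≤ b) (hba : b ≤ a) (ha : a ≤ 1 / 2) {x y : ℝ} (hx0 : 0 ≤ x)
    (hx : x ≤ 1 / 2) (hy0 : 0 ≤ y) (hy : y ≤ 1) :
    (2 - a + x) ^ 2 + (1 - b - y) ^ 2 ≤ farDistSq a b ∨
      (2 + b - y) ^ 2 + (1 - a - x) ^ 2 ≤ farDistSq a b ∨
      (2 - b + y) ^ 2 + (1 - a - x) ^ 2 ≤ farDistSq a b ∨
      (2 - a - y) ^ 2 + (1 + b + x) ^ 2 ≤ farDistSq a b := by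
  by_cases h : x = nextCoord a b ∧ y = b
  · obtain ⟨rfl, rfl⟩ := h
    right; left
    rw [farDistSq, add_sub_cancel_right]
    norm_num
  · rcases exists_lt_farDistSq hb hba ha hx0 hx hy0 hy (not_and_or.1 h) with h | h | h | h
    · exact Or.inl h.le
    · exact Or.inr (Or.inl h.le)
    · exact Or.inr (Or.inr (Or.inl h.le))
    · exact Or.inr (Or.inr (Or.inr h.le))

theorem DistSqLE.lt {p q : E3} {S T : ℝ} (h : DistSqLE p q T) (hS : 0 < S) (hT : T < S) :
    intrinsicDist cubeSurface p q < ENNReal.ofReal √S :=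
  h.trans_lt ((ENNReal.ofReal_lt_ofReal_iff (Real.sqrt_pos.2 hS)).2
    ((Real.sqrt_lt_sqrt_iff_of_pos hS).2 hT))

theorem intrinsicDist_top_lt (hb : 0 ≤ b) (hba : b ≤ a) (ha : a ≤ 1 / 2) {u v : ℝ}
    (hu : u ∈ Icc (0 : ℝ) 1) (hv : v ∈ Icc (0 : ℝ) 1) (h : a < 1 / 2 ∨ 1 / 2 ≤ u)
    (hne : u ≠ 1 - nextCoord a b ∨ v ≠ 1 - b) :
    intrinsicDist cubeSurface !₂[a, b, 0] !₂[u, v, 1] < ENNReal.ofReal √(farDistSq a b) := by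
  have haI : a ∈ Icc (0 : ℝ) 1 := ⟨by linarith, by linarith⟩
  have hbI : b ∈ Icc (0 : ℝ) 1 := ⟨hb, by linarith⟩
  have ha' := one_sub_mem_Icc haI
  have hb' := one_sub_mem_Icc hbI
  have hu' := one_sub_mem_Icc hu
  have hv' := one_sub_mem_Icc hv
  have d4 := (distSqLE_top hbI haI hv hu).swap01
  have d3 := (distSqLE_top hb' haI hv' hu).swap01.flip1
  rw [sub_sub_cancel, sub_sub_cancel] at d3
  rcases le_or_gt (1 / 2) u with h12 | h12
  · rcases exists_lt_farDistSq hb hba ha hu'.1 (by linarith) hv'.1 hv'.2 (hne.imp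
      (fun h h' => h (by linarith)) (fun h h' => h (by linarith))) with h | h | h | h
    · exact (distSqLE_top haI hbI hu hv).lt farDistSq_pos (by nlinarith)
    · exact d3.lt farDistSq_pos (by nlinarith)
    · exact d4.lt farDistSq_pos (by nlinarith)
    · exact (distSqLE_side_side_top haI hbI hu hv).lt farDistSq_pos (by nlinarith)
  · -- As `a < 1 / 2`, each of the four distances at the mirror image `(1 - u, v, 1)` exceeds its
    -- mirrored counterpart at `(u, v, 1)`.
    have ha2 : a < 1 / 2 := h.resolve_right h12.not_ge
    have k : 0 < (1 - 2 * u) * (1 - 2 * a) := mul_pos (by linarith) (by linarith)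
    have d1 := (distSqLE_top ha' hbI hu' hv).flip0
    have g := (distSqLE_side_side_top ha' hbI hu' hv).flip0
    rw [sub_sub_cancel, sub_sub_cancel] at d1 g
    rcases exists_le_farDistSq hb hba ha hu.1 h12.le hv'.1 hv'.2 with h | h | h | h
    · exact d1.lt farDistSq_pos (by nlinarith [hu.1])
    · exact d3.lt farDistSq_pos (by nlinarith)
    · exact d4.lt farDistSq_pos (by nlinarith)
    · exact g.lt farDistSq_pos (by nlinarith [hv.1])

/-- The paths that end in the face `x = 1` at height `z < 1` are shorter than their continuations to
the top edge, for which `exists_le_farDistSq` applies with `x = 0`. For such points the segments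
through `y = 0` or `y = 1` alone are no shorter than those that pass also through `x = 1`. -/
theorem intrinsicDist_side0_lt (hb : 0 ≤ b) (hba : b ≤ a) (ha : a ≤ 1 / 2) {v z : ℝ}
    (hv : v ∈ Icc (0 : ℝ) 1) (hz : 0 ≤ z) (hz1 : z < 1) :
    intrinsicDist cubeSurface !₂[a, b, 0] !₂[1, v, z] < ENNReal.ofReal √(farDistSq a b) := by
  have haI : a ∈ Icc (0 : ℝ) 1 := ⟨by linarith, by linarith⟩
  have hbI : b ∈ Icc (0 : ℝ) 1 := ⟨hb, by linarith⟩
  have hzI : z ∈ Icc (0 : ℝ) 1 := ⟨hz, hz1.le⟩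
  have hb' := one_sub_mem_Icc hbI
  have hv' := one_sub_mem_Icc hv
  have d4 := (distSqLE_side_side haI hb' hv' hzI).flip1
  rw [sub_sub_cancel, sub_sub_cancel] at d4
  have g := distSqLE_side_side haI hbI hv hzI
  rcases exists_le_farDistSq hb hba ha le_rfl (by norm_num) hv'.1 hv'.2 with h | h | h | h
  · exact (distSqLE_side haI hbI hv hzI).lt farDistSq_pos (by nlinarith)
  · exact g.lt farDistSq_pos (by nlinarith [mul_nonneg (add_nonneg haI.1 hb) hv.1])
  · exact d4.lt farDistSq_pos (by nlinarith [mul_nonneg hv'.1 (show 0 ≤ 1 - b + a by linarith)])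
  · exact g.lt farDistSq_pos (by nlinarith)

/-- The analogue of `intrinsicDist_side0_lt` for the face `y = 1`, with `y = 0` in
`exists_le_farDistSq`; the half `u ≤ 1 / 2` is reflected to the other one. -/
theorem intrinsicDist_side1_lt (hb : 0 ≤ b) (hba : b ≤ a) (ha : a ≤ 1 / 2) {u z : ℝ}
    (hu : u ∈ Icc (0 : ℝ) 1) (hz : 0 ≤ z) (hz1 : z < 1) :
    intrinsicDist cubeSurface !₂[a, b, 0] !₂[u, 1, z] < ENNReal.ofReal √(farDistSq a b) := by
  have haI : a ∈ Icc (0 : ℝ) 1 := ⟨by linarith, by linarith⟩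
  have hbI : b ∈ Icc (0 : ℝ) 1 := ⟨hb, by linarith⟩
  have hzI : z ∈ Icc (0 : ℝ) 1 := ⟨hz, hz1.le⟩
  have ha' := one_sub_mem_Icc haI
  have hu' := one_sub_mem_Icc hu
  have d4 := (distSqLE_side hbI haI hu hzI).swap01
  rcases le_total (1 / 2) u with h12 | h12
  · have d2 := (distSqLE_side_side hbI ha' hu' hzI).flip1.swap01
    rw [sub_sub_cancel, sub_sub_cancel] at d2
    rcases exists_le_farDistSq hb hba ha hu'.1 (by linarith) le_rfl zero_le_one with h | h | h | h
    · exact d2.lt farDistSq_pos (by nlinarith [mul_nonneg hu'.1 (show 0 ≤ 1 - a + b by linarith)])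
    · exact d4.lt farDistSq_pos (by nlinarith)
    · exact d4.lt farDistSq_pos (by nlinarith)
    · exact d2.lt farDistSq_pos (by nlinarith [mul_nonneg hb (show 0 ≤ 2 - u by linarith [hu.2])])
  · have d1 := (distSqLE_side_side hbI haI hu hzI).swap01
    have k : 0 ≤ (1 - 2 * u) * (1 - 2 * a) := mul_nonneg (by linarith) (by linarith)
    rcases exists_le_farDistSq hb hba ha hu.1 h12 le_rfl zero_le_one with h | h | h | h
    · exact d1.lt farDistSq_pos (by nlinarith [mul_nonneg hu.1 (show 0 ≤ 1 - a + b by linarith)])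
    · exact d4.lt farDistSq_pos (by nlinarith)
    · exact d4.lt farDistSq_pos (by nlinarith)
    · exact d1.lt farDistSq_pos (by nlinarith [mul_nonneg hb hu.1])

theorem intrinsicDist_lt (hb : 0 ≤ b) (hba : b ≤ a) (ha : a ≤ 1 / 2) {q : E3}
    (hq : q ∈ cubeSurface) (h : a < 1 / 2 ∨ 1 / 2 ≤ q 0)
    (hne : q ≠ !₂[1 - nextCoord a b, 1 - b, 1]) :
    intrinsicDist cubeSurface !₂[a, b, 0] q < ENNReal.ofReal √(farDistSq a b) := by
  have haI : a ∈ Icc (0 : ℝ) 1 := ⟨by linarith, by linarith⟩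
  have hbI : b ∈ Icc (0 : ℝ) 1 := ⟨hb, by linarith⟩
  have h01 := left_mem_Icc.2 (zero_le_one (α := ℝ))
  have ha' := one_sub_mem_Icc haI
  have hb' := one_sub_mem_Icc hbI
  obtain ⟨u, v, z, rfl⟩ : ∃ u v z, q = !₂[u, v, z] := ⟨_, _, _, eq_mk q⟩
  have hS : 4 ≤ farDistSq a b := le_add_of_nonneg_right (sq_nonneg _)
  obtain ⟨⟨hu, hv, hz⟩, hq'⟩ := mk_mem_cubeSurface.1 hq
  rcases eq_or_ne z 1 with rfl | hz1
  · refine intrinsicDist_top_lt hb hba ha hu hv h ?_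
    by_contra! hc
    exact hne (by rw [hc.1, hc.2])
  have hz1' := hz.2.lt_of_ne hz1
  rcases hq' with (rfl | rfl) | (rfl | rfl) | (rfl | rfl)
  · have := (distSqLE_side ha' hbI hv hz).flip0
    rw [sub_sub_cancel, sub_self] at this
    exact this.lt farDistSq_pos (by nlinarith [haI.1, hz.1, hv.1, hv.2, hbI.1, hbI.2])
  · exact intrinsicDist_side0_lt hb hba ha hv hz.1 hz1'
  · have := (distSqLE_side hb' haI hu hz).swap01.flip1
    rw [sub_sub_cancel, sub_self] at this
    exact this.lt farDistSq_pos (by nlinarith [haI.1, hz.1, hu.1, hu.2, hbI.1, hbI.2])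
  · exact intrinsicDist_side1_lt hb hba ha hu hz.1 hz1'
  · refine (DistSqLE.of_face (mk_mem_cubeSurface.2 ⟨⟨haI, hbI, h01⟩, by simp⟩) hq
      (by simp)).lt farDistSq_pos ?_
    nlinarith [haI.1, haI.2, hv.1, hv.2, hu.1, hu.2, hbI.1, hbI.2]
  · exact absurd rfl hz1

end

/-! ### The dynamics of the farthest point map -/

section
variable {a b : ℝ}

theorem mk_mem_farthest (hb : 0 ≤ b) (hba : b ≤ a) (ha : a ≤ 1 / 2) :
    !₂[1 - nextCoord a b, 1 - b, 1] ∈ farthest cubeSurface !₂[a, b, 0] := by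
  have h3 := le_nextCoord hb hba ha
  have h4 := nextCoord_le hb hba ha
  have key : ∀ q ∈ cubeSurface, a < 1 / 2 ∨ 1 / 2 ≤ q 0 → intrinsicDist cubeSurface !₂[a, b, 0] q ≤
      intrinsicDist cubeSurface !₂[a, b, 0] !₂[1 - nextCoord a b, 1 - b, 1] := by
    intro q hq h
    rcases eq_or_ne q !₂[1 - nextCoord a b, 1 - b, 1] with rfl | hne
    · exact le_rfl
    · exact (intrinsicDist_lt hb hba ha hq h hne).le.trans (sqrt_farDistSq_le hb hba ha)
  refine ⟨mk_mem_cubeSurface.2 ⟨⟨⟨by linarith, by linarith⟩, ⟨by linarith, by linarith⟩,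
    by simp⟩, by simp⟩, fun q hq => ?_⟩
  by_cases h : a < 1 / 2 ∨ 1 / 2 ≤ q 0
  · exact key q hq h
  · -- Here `a = 1 / 2`, so that the reflection in the plane `x = 1 / 2` fixes `(a, b, 0)`.
    rw [not_or, not_lt, not_le] at h
    have hfix : cubeSym 1 (fun i => decide (i = 0)) !₂[a, b, 0] = !₂[a, b, 0] := by
      ext i; fin_cases i <;> simp [cubeSym_apply]; linarith
    have := key _ (cubeSym_mem 1 (fun i => decide (i = 0)) hq) (Or.inr (by
      simp [cubeSym_apply]; linarith))
    rwa [← hfix, intrinsicDist_cubeSym, hfix] at this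

theorem eq_of_mem_farthest (hb : 0 ≤ b) (hba : b ≤ a) (ha : a ≤ 1 / 2) {q : E3}
    (hq : q ∈ farthest cubeSurface !₂[a, b, 0]) (h : a < 1 / 2 ∨ 1 / 2 ≤ q 0) :
    q = !₂[1 - nextCoord a b, 1 - b, 1] := by
  by_contra hne
  exact (hq.2 _ (mk_mem_farthest hb hba ha).1).not_gt
    ((intrinsicDist_lt hb hba ha hq.1 h hne).trans_le (sqrt_farDistSq_le hb hba ha))

theorem iota_image_farthest (hb : 0 ≤ b) (hba : b ≤ a) (ha : a < 1 / 2) :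
    iota '' farthest cubeSurface !₂[a, b, 0] = {!₂[nextCoord a b, b, 0]} := by
  have : farthest cubeSurface !₂[a, b, 0] = {!₂[1 - nextCoord a b, 1 - b, 1]} :=
    Subset.antisymm (fun q hq => eq_of_mem_farthest hb hba ha.le hq (Or.inl ha))
      (singleton_subset_iff.2 (mk_mem_farthest hb hba ha.le))
  rw [this, image_singleton]
  congr 1
  ext i; fin_cases i <;> simp [iota]

/-- The point `p` is the image of `(a, b, 0)` under a symmetry of the cube. The points `(a, b, 0)`
with `0 ≤ b ≤ a ≤ 1 / 2` form a fundamental domain of the surface. -/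
def FoldsTo (p : E3) (a b : ℝ) : Prop := ∃ σ ε, p = cubeSym σ ε !₂[a, b, 0]

theorem exists_foldsTo {p : E3} (hp : p ∈ cubeSurface) :
    ∃ a b, 0 ≤ b ∧ b ≤ a ∧ a ≤ 1 / 2 ∧ FoldsTo p a b := by
  obtain ⟨h, k, hk⟩ := mem_cubeSurface.1 hp
  -- Reflect every coordinate into `[0, 1 / 2]`, and sort; the least one is then zero.
  let c : Fin 3 → ℝ := fun i => min (p i) (1 - p i)
  have hc0 : ∀ i, 0 ≤ c i := fun i => le_min (h i).1 (sub_nonneg.2 (h i).2)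
  have hc1 : ∀ i, c i ≤ 1 / 2 := fun i => by
    rcases le_total (p i) (1 / 2) with h | h
    · exact (min_le_left _ _).trans h
    · exact (min_le_right _ _).trans (by linarith)
  have hck : c k = 0 := by rcases hk with hk | hk <;> simp [c, hk]
  have hm : Monotone (c ∘ Tuple.sort c) := Tuple.monotone_sort c
  have hz : c (Tuple.sort c 0) = 0 := by
    refine le_antisymm ?_ (hc0 _)
    have := hm (Fin.zero_le ((Tuple.sort c).symm k))
    simpa [hck] using this
  refine ⟨c (Tuple.sort c 2), c (Tuple.sort c 1), hc0 _, hm (by decide), hc1 _,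
    (Tuple.sort c).symm.trans Fin.revPerm, fun i => decide (1 / 2 < p i), ?_⟩
  have hs : ∀ j : Fin 3, (!₂[c (Tuple.sort c 2), c (Tuple.sort c 1), 0] : E3) (Fin.rev j) =
      c (Tuple.sort c j) := by
    intro j; fin_cases j
    · exact hz.symm
    · rfl
    · rfl
  ext i
  rw [cubeSym_apply, Equiv.trans_apply, Fin.revPerm_apply, hs, Equiv.apply_symm_apply]
  by_cases hi : 1 / 2 < p i
  · rw [show c i = 1 - p i from min_eq_right (by linarith), if_pos (decide_eq_true hi),
      sub_sub_cancel]
  · rw [show c i = p i from min_eq_left (by linarith), if_neg (by simpa using hi)]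

theorem FoldsTo.map {p : E3} (h : FoldsTo p a b) (σ : Equiv.Perm (Fin 3)) (ε : Fin 3 → Bool) :
    FoldsTo (cubeSym σ ε p) a b := by
  obtain ⟨τ, δ, rfl⟩ := h
  exact ⟨_, _, cubeSym_cubeSym _ _ _ _ _⟩

/-- In the fundamental domain the farthest point map is `(a, b) ↦ (nextCoord a b, b)`, also on the
side `a = 1 / 2`, where there are two farthest points that are mirror images. -/
theorem FoldsTo.of_mem_farthest (hb : 0 ≤ b) (hba : b ≤ a) (ha : a ≤ 1 / 2) {p q : E3}
    (h : FoldsTo p a b) (hq : q ∈ farthest cubeSurface p) : FoldsTo q (nextCoord a b) b := by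
  obtain ⟨σ, ε, rfl⟩ := h
  rw [← cubeSym_apply_symm σ ε q] at hq ⊢
  rw [cubeSym_mem_farthest] at hq
  refine FoldsTo.map ?_ _ _
  generalize cubeSym σ.symm (fun i => ε (σ.symm i)) q = r at hq
  by_cases h : a < 1 / 2 ∨ 1 / 2 ≤ r 0
  · refine ⟨1, fun _ => true, (eq_of_mem_farthest hb hba ha hq h).trans ?_⟩
    ext i; fin_cases i <;> simp [cubeSym_apply]
  · rw [not_or, not_lt, not_le] at h
    have hfix : cubeSym 1 (fun i => decide (i = 0)) !₂[a, b, 0] = !₂[a, b, 0] := by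
      ext i; fin_cases i <;> simp [cubeSym_apply]; linarith
    rw [← cubeSym_mem_farthest (σ := 1) (ε := fun i => decide (i = 0)), hfix] at hq
    have hr := eq_of_mem_farthest hb hba ha hq (Or.inr (by simp [cubeSym_apply]; linarith))
    have hr' : r = cubeSym 1 (fun i => decide (i = 0))
        (cubeSym 1 (fun i => decide (i = 0)) r) := by
      ext i; fin_cases i <;> simp [cubeSym_apply]
    rw [hr', hr]
    refine FoldsTo.map ⟨1, fun _ => true, ?_⟩ _ _
    ext i; fin_cases i <;> simp [cubeSym_apply]

/-- The farthest point map contracts the distance to the diagonal by a factor that depends only on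
`b`. -/
theorem nextCoord_sub_le (hb : 0 ≤ b) (hba : b ≤ a) (ha : a ≤ 1 / 2) :
    nextCoord a b - b ≤ max (2 / 3) (1 / 2 + b) * (a - b) := by
  rw [sub_le_iff_le_add]
  have hab := sub_nonneg.2 hba
  refine max_le ((div_le_iff₀ (by linarith)).2 ?_) ((div_le_iff₀ (by linarith)).2 ?_)
  · have h := mul_le_mul_of_nonneg_right (le_max_right (2 / 3) (1 / 2 + b)) hab
    refine le_trans ?_ (mul_le_mul_of_nonneg_right (add_le_add_left h b) (by linarith))
    nlinarith [mul_nonneg hab (mul_nonneg (show 0 ≤ 1 - 2 * a by linarith)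
      (show 0 ≤ 1 + 2 * b by linarith))]
  · have h := mul_le_mul_of_nonneg_right (le_max_left (2 / 3) (1 / 2 + b)) hab
    refine le_trans ?_ (mul_le_mul_of_nonneg_right (add_le_add_left h b) (by linarith))
    nlinarith [mul_nonneg hab (show 0 ≤ 1 / 2 + b - a by linarith), sq_nonneg b]

theorem iterate_nextCoord_mem (hb : 0 ≤ b) (hba : b ≤ a) (ha : a ≤ 1 / 2) (k : ℕ) :
    b ≤ (fun t => nextCoord t b)^[k] a ∧ (fun t => nextCoord t b)^[k] a ≤ a := by
  induction k with
  | zero => exact ⟨hba, le_rfl⟩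
  | succ k ih =>
    rw [Function.iterate_succ_apply']
    exact ⟨le_nextCoord hb ih.1 (ih.2.trans ha),
      (nextCoord_le hb ih.1 (ih.2.trans ha)).trans ih.2⟩

theorem tendsto_iterate_nextCoord (hb : 0 ≤ b) (hba : b ≤ a) (ha : a ≤ 1 / 2) :
    Tendsto (fun k => (fun t => nextCoord t b)^[k] a) atTop (𝓝 b) := by
  have hmem := iterate_nextCoord_mem hb hba ha
  rcases hba.eq_or_lt with rfl | hlt
  · simp only [fun k => le_antisymm (hmem k).2 (hmem k).1, tendsto_const_nhds]
  set c := max (2 / 3) (1 / 2 + b)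
  have hc0 : 0 ≤ c := le_max_of_le_left (by norm_num)
  have hc1 : c < 1 := max_lt (by norm_num) (by linarith)
  have hle : ∀ k, (fun t => nextCoord t b)^[k] a ≤ b + c ^ k * (a - b) := by
    intro k
    induction k with
    | zero => simp
    | succ k ih =>
      have h1 := nextCoord_sub_le hb (hmem k).1 ((hmem k).2.trans ha)
      have h2 := mul_le_mul_of_nonneg_left (sub_le_iff_le_add'.2 ih) hc0
      rw [Function.iterate_succ_apply', pow_succ']
      linarith
  refine tendsto_of_tendsto_of_tendsto_of_le_of_le tendsto_const_nhds ?_ (fun k => (hmem k).1) hle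
  simpa using ((tendsto_pow_atTop_nhds_zero_of_lt_one hc0 hc1).mul_const (a - b)).const_add b

end

/-! ### The diagonals of the facets and the limit set -/

theorem foldsTo_of_mem_facetDiagonals {x : E3} {i : Fin 3} {c : ℝ} (hx : x ∈ facetDiagonals i c) :
    ∃ b, 0 ≤ b ∧ b ≤ 1 / 2 ∧ FoldsTo x b b := by
  obtain ⟨v, hv, w, hw, hvi, hwi, hne, s, t, hs, ht, hst, rfl⟩ := hx
  wlog h : t ≤ s generalizing v w s t
  · rw [add_comm]
    exact this w hw v hv hwi hvi (fun j hj => (hne j hj).symm) t s ht hs (by linarith)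
      (le_of_not_ge h)
  refine ⟨t, ht, by linarith, Equiv.swap i 2, fun j => decide (v j = 1), ?_⟩
  obtain rfl : s = 1 - t := by linarith
  ext j
  rw [cubeSym_apply]
  by_cases hj : j = i
  · subst hj
    have : (!₂[t, t, 0] : E3) (Equiv.swap j 2 j) = 0 := by simp
    rw [this]
    have hwv : w j = v j := hwi.trans hvi.symm
    rcases hv j with h0 | h0 <;> simp [hwv, h0]
  · have h2 : Equiv.swap i 2 j ≠ 2 := by
      intro h
      exact hj ((Equiv.swap i 2).injective (h.trans (Equiv.swap_apply_left i 2).symm))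
    have : ∀ k : Fin 3, k ≠ 2 → (!₂[t, t, 0] : E3) k = t := by
      intro k hk; fin_cases k <;> simp at hk ⊢
    rw [this _ h2]
    have := hne j hj
    rcases hv j with h0 | h0 <;> rcases hw j with h1 | h1 <;> simp [h0, h1] at this ⊢

theorem FoldsTo.mem_facetDiagonals {x : E3} {b : ℝ} (hb : 0 ≤ b) (hb' : b ≤ 1 / 2)
    (h : FoldsTo x b b) : x ∈ ⋃ i : Fin 3, (facetDiagonals i 0 ∪ facetDiagonals i 1) := by
  obtain ⟨σ, ε, rfl⟩ := h
  have hx : cubeSym σ ε !₂[b, b, 0] ∈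
      facetDiagonals (σ.symm 2) (if ε (σ.symm 2) then 1 else 0) := by
    refine ⟨cubeSym σ ε !₂[0, 0, 0], fun j => ?_, cubeSym σ ε !₂[1, 1, 0], fun j => ?_, ?_, ?_,
      fun j hj => ?_, 1 - b, b, by linarith, hb, by ring, ?_⟩
    · rw [cubeSym_apply]
      generalize σ j = k
      fin_cases k <;> cases ε j <;> simp
    · rw [cubeSym_apply]
      generalize σ j = k
      fin_cases k <;> cases ε j <;> simp
    · simp [cubeSym_apply]
    · simp [cubeSym_apply]
    · have hj' : σ j ≠ 2 := fun h => hj (by rw [← h, Equiv.symm_apply_apply])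
      rw [cubeSym_apply, cubeSym_apply]
      generalize σ j = k at hj'
      fin_cases k <;> cases ε j <;> simp at hj' ⊢
    · ext j
      simp only [PiLp.add_apply, PiLp.smul_apply, cubeSym_apply, smul_eq_mul]
      generalize σ j = k
      fin_cases k <;> cases ε j <;> simp
  refine mem_iUnion.2 ⟨σ.symm 2, ?_⟩
  cases hε : ε (σ.symm 2)
  · exact Or.inl (by simpa [hε] using hx)
  · exact Or.inr (by simpa [hε] using hx)

theorem mem_facetDiagonals_iff {x : E3} :
    x ∈ ⋃ i : Fin 3, (facetDiagonals i 0 ∪ facetDiagonals i 1) ↔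
      ∃ b, 0 ≤ b ∧ b ≤ 1 / 2 ∧ FoldsTo x b b := by
  constructor
  · intro hx
    obtain ⟨i, h | h⟩ := mem_iUnion.1 hx <;> exact foldsTo_of_mem_facetDiagonals h
  · rintro ⟨b, hb, hb', h⟩
    exact h.mem_facetDiagonals hb hb'

theorem isClosed_facetDiagonals :
    IsClosed (⋃ i : Fin 3, (facetDiagonals i 0 ∪ facetDiagonals i 1)) := by
  have : (⋃ i : Fin 3, (facetDiagonals i 0 ∪ facetDiagonals i 1)) =
      ⋃ σ : Equiv.Perm (Fin 3), ⋃ ε : Fin 3 → Bool,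
        (fun b : ℝ => cubeSym σ ε !₂[b, b, 0]) '' Icc 0 (1 / 2) := by
    ext x
    rw [mem_facetDiagonals_iff]
    simp only [mem_iUnion, mem_image, FoldsTo]
    constructor
    · rintro ⟨b, hb, hb', σ, ε, rfl⟩
      exact ⟨σ, ε, b, ⟨hb, hb'⟩, rfl⟩
    · rintro ⟨σ, ε, b, ⟨hb, hb'⟩, rfl⟩
      exact ⟨b, hb, hb', σ, ε, rfl⟩
  rw [this]
  refine isClosed_iUnion_of_finite fun σ => isClosed_iUnion_of_finite fun ε => ?_
  refine (isCompact_Icc.image ?_).isClosed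
  refine (isometry_cubeSym σ ε).continuous.comp ?_
  fun_prop

theorem limitSet_subset :
    limitSet cubeSurface ⊆ ⋃ i : Fin 3, (facetDiagonals i 0 ∪ facetDiagonals i 1) := by
  rintro x ⟨q, ⟨hq0, hq⟩, hx⟩
  obtain ⟨a, b, hb, hba, ha, h0⟩ := exists_foldsTo hq0
  have hmem := iterate_nextCoord_mem hb hba ha
  have hfold : ∀ k, FoldsTo (q k) ((fun t => nextCoord t b)^[k] a) b := by
    intro k
    induction k with
    | zero => exact h0
    | succ k ih =>
      rw [Function.iterate_succ_apply']
      exact ih.of_mem_farthest hb (hmem k).1 ((hmem k).2.trans ha) (hq k)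
  rw [← isClosed_facetDiagonals.closure_eq, Metric.mem_closure_iff]
  intro r hr
  have h1 := hx.frequently (Metric.ball_mem_nhds x (half_pos hr))
  have h2 := (tendsto_iterate_nextCoord hb hba ha).eventually
    (Metric.ball_mem_nhds b (half_pos hr))
  obtain ⟨k, hk1, hk2⟩ := (h1.and_eventually h2).exists
  obtain ⟨σ, ε, hk⟩ := hfold k
  refine ⟨cubeSym σ ε !₂[b, b, 0], mem_facetDiagonals_iff.2 ⟨b, hb, hba.trans ha, σ, ε, rfl⟩, ?_⟩
  have h3 : dist (q k) (cubeSym σ ε !₂[b, b, 0]) =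
      dist ((fun t => nextCoord t b)^[k] a) b := by
    rw [hk, (isometry_cubeSym σ ε).dist_eq, EuclideanSpace.dist_eq, Fin.sum_univ_three]
    simp
  have h4 := dist_triangle_left x (cubeSym σ ε !₂[b, b, 0]) (q k)
  rw [h3] at h4
  linarith

/-- A point on a diagonal of a facet and its point reflection are farthest points of each other, so
that the two form a periodic orbit. -/
theorem subset_limitSet :
    (⋃ i : Fin 3, (facetDiagonals i 0 ∪ facetDiagonals i 1)) ⊆ limitSet cubeSurface := by
  intro x hx
  obtain ⟨b, hb, hb', σ, ε, rfl⟩ := mem_facetDiagonals_iff.1 hx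
  have hn : nextCoord b b = b :=
    le_antisymm (nextCoord_le hb le_rfl hb') (le_nextCoord hb le_rfl hb')
  have hf := mk_mem_farthest hb le_rfl hb'
  rw [hn] at hf
  have hy : (!₂[1 - b, 1 - b, 1] : E3) = cubeSym 1 (fun _ => true) !₂[b, b, 0] := by
    ext i; fin_cases i <;> simp [cubeSym_apply]
  have hy' : (!₂[b, b, 0] : E3) = cubeSym 1 (fun _ => true) !₂[1 - b, 1 - b, 1] := by
    ext i; fin_cases i <;> simp [cubeSym_apply]
  have hf' := (cubeSym_mem_farthest (σ := 1) (ε := fun _ => true)).2 hf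
  rw [← hy, ← hy'] at hf'
  refine ⟨fun k => if Even k then cubeSym σ ε !₂[b, b, 0] else cubeSym σ ε !₂[1 - b, 1 - b, 1],
    ⟨?_, fun k => ?_⟩, ?_⟩
  · simp only [Even.zero, if_true]
    exact cubeSym_mem σ ε (mk_mem_cubeSurface.2 ⟨⟨⟨hb, by linarith⟩, ⟨hb, by linarith⟩, by simp⟩,
      by simp⟩)
  · by_cases hk : Even k
    · simpa [hk, Nat.even_add_one] using cubeSym_mem_farthest.2 hf
    · simpa [hk, Nat.even_add_one] using cubeSym_mem_farthest.2 hf'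
  · rw [mapClusterPt_iff_frequently]
    intro s hs
    rw [frequently_atTop]
    exact fun n => ⟨2 * n, by omega, by simpa using mem_of_mem_nhds hs⟩

end FarthestPoint

theorem mainTheorem5 :
    FarthestPoint.limitSet FarthestPoint.cubeSurface =
        (⋃ i : Fin 3, (FarthestPoint.facetDiagonals i 0 ∪ FarthestPoint.facetDiagonals i 1)) ∧
      ∀ a b : ℝ, 0 ≤ b → b ≤ a → a < 1 / 2 →
        FarthestPoint.iota '' FarthestPoint.farthest FarthestPoint.cubeSurface !₂[a, b, 0] =
            {!₂[max ((a + 2 * b * (1 - b)) / (3 - 2 * a))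
                ((a + b) * (1 - b) / (2 + b - a)), b, 0]} ∧
          ∃ q : ℕ → FarthestPoint.E3,
            q 0 = !₂[a, b, 0] ∧
            (∀ k, FarthestPoint.iota '' FarthestPoint.farthest FarthestPoint.cubeSurface (q k) =
              {q (k + 1)}) ∧
            Tendsto q atTop (𝓝 !₂[b, b, 0]) := by
  refine ⟨FarthestPoint.limitSet_subset.antisymm FarthestPoint.subset_limitSet,
    fun a b hb hba ha => ⟨FarthestPoint.iota_image_farthest hb hba ha,
      fun k => !₂[(fun t => FarthestPoint.nextCoord t b)^[k] a, b, 0], rfl, fun k => ?_, ?_⟩⟩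
  · obtain ⟨h1, h2⟩ := FarthestPoint.iterate_nextCoord_mem hb hba ha.le k
    simp only [FarthestPoint.iota_image_farthest hb h1 (h2.trans_lt ha),
      Function.iterate_succ_apply']
  · have hc : Continuous fun t : ℝ => (!₂[t, b, 0] : FarthestPoint.E3) := by fun_prop
    exact (hc.tendsto b).comp (FarthestPoint.tendsto_iterate_nextCoord hb hba ha.le)
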